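/- Let $g$ be a smooth Riemannian metric on $\mathbf{R}^3$ whose coefficients $g_{\alpha\beta}$ in the standard coordinates are bounded together with all their derivatives of every order, and let $\Gamma^\alpha_{\beta\gamma}$ be its Christoffel symbols. Function spaces on $S^2$ are taken with respect to the round metric on $S^2$ and the Euclidean metric on $\mathbf{R}^3$. Let $$B=\{F\in W^{2,2}(S^2,\mathbf{R}^3)\cap W^{1,\infty}(S^2,\mathbf{R}^3)\;:\;\bar g,\ \bar g^{\#}\in L^\infty(S^2)\cap W^{1,2}(S^2)\},$$ where $\bar g=F^*g$ is the pull-back metric, required to be invertible almost everywhere, and $\bar g^{\#}$ is its inverse. For $F\in B$ let $\nu$ be a unit normal along $F$ with respect to $g$ (defined almost everywhere). In local coordinates on $S^2$, with $F_i^\alpha=\partial_iF^\alpha$ and $F_{ij}^\alpha=\partial_i\partial_jF^\alpha$ the weak derivatives, put $$h_{ij}=-\big(F_{ij}^\alpha+(\Gamma^\alpha_{\beta\gamma}\circ F)F_i^\beta F_j^\gamma\big)(g_{\alpha\delta}\circ F)\,\nu^\delta,\qquad H=\bar g^{ij}h_{ij},\qquad \mathcal W(F)=\frac12\int_{S^2}H^2\,d\mu,$$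 where $d\mu=\sqrt{\det\bar g}\,dx$ is the area measure of $\bar g$. **Proposition.** Let $F_k$ $(k\in\mathbf{N})$ and $F$ belong to $B$. If $F_k\rightharpoonup F$ weakly in $W^{2,2}(S^2,\mathbf{R}^3)$ and $F_k\rightharpoonup F$ weakly-$*$ in $W^{1,\infty}(S^2,\mathbf{R}^3)$ (that is, $F_k$ and its first derivatives converge weakly-$*$ in $L^\infty$ to $F$ and its first derivatives), then $$\mathcal W(F)\le\liminf_{k\to\infty}\mathcal W(F_k).$$ -/

import Mathlib

open MeasureTheory Filter Topology
open scoped ContDiff ENNReal Matrix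

noncomputable section

namespace WillmoreLSC

/-- The coordinate plane. -/
abbrev Plane : Type := EuclideanSpace ℝ (Fin 2)

/-- The ambient space `ℝ³`. -/
abbrev Space : Type := EuclideanSpace ℝ (Fin 3)

/-- The unit sphere `S² ⊂ ℝ³`. -/
abbrev S2 : Type := Metric.sphere (0 : Space) 1

/-! ### Local Sobolev spaces on the coordinate plane -/

/-- `u' = ∂ᵢ u` in the sense of distributions on the plane. -/
def IsWeakPartial (i : Fin 2) (u u' : Plane → ℝ) : Prop :=
  LocallyIntegrable u ∧ LocallyIntegrable u' ∧
    ∀ φ : Plane → ℝ, ContDiff ℝ ∞ φ → HasCompactSupport φ →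
      ∫ w, u w * fderiv ℝ φ w (EuclideanSpace.single i 1) = - ∫ w, u' w * φ w

open Classical in
/-- The weak partial derivative `∂ᵢ u` (unique up to a null set); it is `0` by convention if `u` has
no weak partial derivative in the direction `i`. -/
def weakPartial (i : Fin 2) (u : Plane → ℝ) : Plane → ℝ :=
  if h : ∃ u', IsWeakPartial i u u' then h.choose else 0

/-- `u ∈ L^p_loc(ℝ²)`. -/
def MemLpLoc (p : ℝ≥0∞) (u : Plane → ℝ) : Prop :=
  ∀ R : ℝ, MemLp u p (volume.restrict (Metric.ball (0 : Plane) R))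

/-- `u ∈ W^{k,p}_loc(ℝ²)`. -/
def MemSobolevLoc : ℕ → ℝ≥0∞ → (Plane → ℝ) → Prop
  | 0, p, u => MemLpLoc p u
  | k + 1, p, u => MemLpLoc p u ∧
      ∀ i : Fin 2, ∃ u', IsWeakPartial i u u' ∧ MemSobolevLoc k p u'

/-- `∫ uₖ ψ → ∫ u ψ` for all compactly supported `ψ ∈ L^q(ℝ²)`. For `q = 2` this is weak convergence
in `L²` on every ball, for `q = 1` it is weak-* convergence in `L^∞` on every ball. -/
def TendstoTestedBy (q : ℝ≥0∞) (uk : ℕ → Plane → ℝ) (u : Plane → ℝ) : Prop :=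
  ∀ ψ : Plane → ℝ, MemLp ψ q → HasCompactSupport ψ →
    Tendsto (fun k => ∫ w, uk k w * ψ w) atTop (𝓝 (∫ w, u w * ψ w))

/-! ### Maps on the sphere in stereographic coordinates

The stereographic charts `stereographic' 2 v` of Mathlib, one for every pole `v ∈ S²`, map
`S² ∖ {v}` onto the whole plane and form a smooth atlas of `S²`. Since `S²` is compact and is covered
by finitely many coordinate balls, whose closures are compact in their charts, a function or tensor
is of class `L^p` or `W^{k,p}` on `S²` with respect to the round metric if and only if all its
components in all these charts are of class `L^p_loc` or `W^{k,p}_loc`, and likewise for weak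
and weak-* convergence. -/

instance instFactFinrankSpace : Fact (Module.finrank ℝ Space = 2 + 1) := ⟨by simp⟩

/-- The inverse of the stereographic chart with pole `v`, a smooth parametrization of `S² ∖ {v}`. -/
def param (v : S2) : Plane → S2 := fun w => (stereographic' 2 v).symm w

/-- The component `F^α` of `F` in the stereographic coordinates with pole `v`. -/
def coord (F : S2 → Space) (v : S2) (α : Fin 3) : Plane → ℝ :=
  fun w => F (param v w) α

/-- The first derivatives `F_i^α` in the stereographic coordinates with pole `v`. -/
def d1 (F : S2 → Space) (v : S2) (i : Fin 2) (α : Fin 3) : Plane → ℝ :=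
  weakPartial i (coord F v α)

/-- The second derivatives `F_{ij}^α` in the stereographic coordinates with pole `v`. -/
def d2 (F : S2 → Space) (v : S2) (i j : Fin 2) (α : Fin 3) : Plane → ℝ :=
  weakPartial i (weakPartial j (coord F v α))

/-- `F ∈ W^{k,p}(S², ℝ³)`. -/
def MemSobolevSphere (k : ℕ) (p : ℝ≥0∞) (F : S2 → Space) : Prop :=
  ∀ (v : S2) (α : Fin 3), MemSobolevLoc k p (coord F v α)

/-- `F_k ⇀ F` weakly in `W^{2,2}(S², ℝ³)`: weak convergence in `L²` of the maps and of all their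
derivatives of first and second order. -/
def TendstoWeaklyW22 (Fk : ℕ → S2 → Space) (F : S2 → Space) : Prop :=
  ∀ (v : S2) (α : Fin 3),
    TendstoTestedBy 2 (fun k => coord (Fk k) v α) (coord F v α) ∧
    (∀ i, TendstoTestedBy 2 (fun k => d1 (Fk k) v i α) (d1 F v i α)) ∧
    (∀ i j, TendstoTestedBy 2 (fun k => d2 (Fk k) v i j α) (d2 F v i j α))

/-- `F_k ⇀ F` weakly-* in `W^{1,∞}(S², ℝ³)`: weak-* convergence in `L^∞` (tested by `L¹`) of the maps
and of their first derivatives. -/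
def TendstoWeakStarW1Infty (Fk : ℕ → S2 → Space) (F : S2 → Space) : Prop :=
  ∀ (v : S2) (α : Fin 3),
    TendstoTestedBy 1 (fun k => coord (Fk k) v α) (coord F v α) ∧
    (∀ i, TendstoTestedBy 1 (fun k => d1 (Fk k) v i α) (d1 F v i α))

/-! ### The ambient metric -/

/-- `g` is a smooth Riemannian metric on `ℝ³` (given by its matrix in standard coordinates) all of
whose coefficients are bounded together with all their derivatives of every order. -/
structure IsBoundedSmoothMetric (g : Space → Matrix (Fin 3) (Fin 3) ℝ) : Prop where
  smooth : ∀ α β, ContDiff ℝ ∞ (fun x => g x α β)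
  posDef : ∀ x, (g x).PosDef
  bounded : ∀ (α β : Fin 3) (m : ℕ), ∃ C : ℝ, ∀ x, ‖iteratedFDeriv ℝ m (fun y => g y α β) x‖ ≤ C

/-- `∂_γ g_{αβ}` at `x`. -/
def metricPartial (g : Space → Matrix (Fin 3) (Fin 3) ℝ) (γ α β : Fin 3) (x : Space) : ℝ :=
  fderiv ℝ (fun y => g y α β) x (EuclideanSpace.single γ 1)

/-- The Christoffel symbols `Γ^α_{βγ}` of `g` at `x`. -/
def christoffel (g : Space → Matrix (Fin 3) (Fin 3) ℝ) (α β γ : Fin 3) (x : Space) : ℝ :=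
  (1 / 2) * ∑ δ, (g x)⁻¹ α δ *
    (metricPartial g β δ γ x + metricPartial g γ δ β x - metricPartial g δ β γ x)

/-! ### Geometry of a parametrization, in the stereographic coordinates with pole `v` -/

section Geometry

variable (g : Space → Matrix (Fin 3) (Fin 3) ℝ) (F : S2 → Space) (v : S2)

/-- The ambient metric along `F`, i.e. `g ∘ F`. -/
def metricAlong (w : Plane) : Matrix (Fin 3) (Fin 3) ℝ :=
  g (F (param v w))

/-- The pull-back metric `ḡ_{ij} = g_{αβ}(F) F_i^α F_j^β`. -/
def pullbackMetric (w : Plane) : Matrix (Fin 2) (Fin 2) ℝ :=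
  Matrix.of fun i j => ∑ α, ∑ β, metricAlong g F v w α β * d1 F v i α w * d1 F v j β w

/-- The covector `F_1 × F_2`, which annihilates `F_1` and `F_2`. -/
def conormal (w : Plane) : Fin 3 → ℝ :=
  crossProduct (fun α => d1 F v 0 α w) (fun α => d1 F v 1 α w)

/-- The unit normal `ν` with respect to `g`: the `g`-dual vector of `F_1 × F_2`, normalized. -/
def unitNormal (w : Plane) : Fin 3 → ℝ :=
  (Real.sqrt (conormal F v w ⬝ᵥ ((metricAlong g F v w)⁻¹ *ᵥ conormal F v w)))⁻¹ •
    ((metricAlong g F v w)⁻¹ *ᵥ conormal F v w)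

/-- The second fundamental form
`h_{ij} = -(F_{ij}^α + Γ^α_{βγ}(F) F_i^β F_j^γ) g_{αδ}(F) ν^δ`, which is the normal component of
`F_{ij}^α = -h_{ij} ν^α + Γ̄_{ij}^m F_m^α - Γ^α_{βγ}(F) F_i^β F_j^γ`. -/
def secondFundamentalForm (i j : Fin 2) (w : Plane) : ℝ :=
  -∑ α, ∑ δ,
    (d2 F v i j α w +
      ∑ β, ∑ γ, christoffel g α β γ (F (param v w)) *
        d1 F v i β w * d1 F v j γ w) *
      metricAlong g F v w α δ * unitNormal g F v w δ

/-- The mean curvature `H = ḡ^{ij} h_{ij}`. -/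
def meanCurvature (w : Plane) : ℝ :=
  ∑ i, ∑ j, (pullbackMetric g F v w)⁻¹ i j * secondFundamentalForm g F v i j w

end Geometry

/-- The class `B` of all `F ∈ W^{2,2}(S², ℝ³) ∩ W^{1,∞}(S², ℝ³)` for which the pull-back metric
`ḡ = F^* g` is invertible almost everywhere, and `ḡ` and its inverse `ḡ^#` belong to
`L^∞(S²) ∩ W^{1,2}(S²)`. -/
structure MemB (g : Space → Matrix (Fin 3) (Fin 3) ℝ) (F : S2 → Space) : Prop where
  memW22 : MemSobolevSphere 2 2 F
  memW1Infty : MemSobolevSphere 1 ∞ F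
  nondegenerate : ∀ v : S2, ∀ᵐ w : Plane, (pullbackMetric g F v w).det ≠ 0
  metric_memLInfty : ∀ (v : S2) (i j : Fin 2), MemLpLoc ∞ (fun w => pullbackMetric g F v w i j)
  metric_memW12 : ∀ (v : S2) (i j : Fin 2),
    MemSobolevLoc 1 2 (fun w => pullbackMetric g F v w i j)
  inverse_memLInfty : ∀ (v : S2) (i j : Fin 2),
    MemLpLoc ∞ (fun w => (pullbackMetric g F v w)⁻¹ i j)
  inverse_memW12 : ∀ (v : S2) (i j : Fin 2),
    MemSobolevLoc 1 2 (fun w => (pullbackMetric g F v w)⁻¹ i j)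

/-- The north pole `(0, 0, 1)`. -/
def northPole : S2 := ⟨EuclideanSpace.single 2 1, by simp⟩

/-- The Willmore functional `W(F) = ½ ∫ H² dμ`, with `dμ = √(det ḡ) dx` the induced area measure.
The integral over `S²` is written in the stereographic coordinates from the north pole, which cover
`S²` up to one point; `H² dμ` does not depend on the coordinates. -/
def willmore (g : Space → Matrix (Fin 3) (Fin 3) ℝ) (F : S2 → Space) : ℝ≥0∞ :=
  2⁻¹ * ∫⁻ w : Plane, ENNReal.ofReal
    (meanCurvature g F northPole w ^ 2 * Real.sqrt (pullbackMetric g F northPole w).det)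

end WillmoreLSC

end

/-!
The Willmore functional is weakly lower semicontinuous because its integrand is a convex function,
in fact a square, of an expression that is affine in the second derivatives:
`H² √(det ḡ) = (∑ A_{ijα} (F_{ij}^α + Γ^α_{βγ} F_i^β F_j^γ))²`, where the coefficients `A` depend
only on the first-order jet `(F, ∂F)` (`meanCurvature_sq_mul_sqrt`).

*Strong convergence of the jets.* By Rellich's theorem (`tendsto_eLpNorm_ball_of_tendsto_weakly`),
weak convergence in `W^{2,2}` yields strong convergence of `F_k` and `∂F_k` in `L²` on every
coordinate ball, hence convergence almost everywhere along a subsequence. Rellich's theorem is proved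
by Plancherel: after multiplication by a cutoff function the Fourier transforms converge pointwise and
boundedly, and the bound on the derivatives controls them uniformly outside large balls.

*Convergence of the coefficients.* The functions `A` are continuous at every nondegenerate jet
(`continuousAt_jetCoeff`): there `F_1 × F_2` does not vanish, so the unit normal depends continuously
on the jet. As the jet of `F` is nondegenerate almost everywhere, the coefficients along `F_k`
converge almost everywhere. They need not be bounded uniformly in `k`, because nothing controls the
inverses of the metrics `F_k^* g` uniformly.

*Passage to the limit.* `lintegral_sq_le_of_weak_tendsto` gives lower semicontinuity under almost
everywhere convergence of the coefficients and weak `L²` convergence of the second derivatives. It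
integrates `a_k² ≥ 2 a_k φ_k - φ_k²` for `φ_k` equal to the limit `a` of the `a_k`, cut off where `a`
or its constituents are large and where the coefficients are far from their limits. With this choice
the products of `φ_k` and the coefficients are bounded and converge strongly in `L²`. Removing the
cutoff by Fatou's lemma and exhausting the plane by balls gives the claim.
-/

namespace WillmoreLSC

/-! ### Weak convergence in `L²` and lower semicontinuity -/

section WeakConvergence

variable {α : Type*} [MeasurableSpace α] {μ : Measure α}

lemma inner_toLp_eq_integral {f g : α → ℝ} (hf : MemLp f 2 μ) (hg : MemLp g 2 μ) :
    inner ℝ (hf.toLp f) (hg.toLp g) = ∫ x, f x * g x ∂μ := by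
  rw [L2.inner_def]
  apply integral_congr_ae
  filter_upwards [hf.coeFn_toLp, hg.coeFn_toLp] with x h1 h2
  simp [h1, h2, mul_comm]

/-- The uniform boundedness principle in `L²`. -/
lemma exists_eLpNorm_le_of_weak_tendsto {Y : ℕ → α → ℝ} {Y' : α → ℝ} (hY : ∀ n, MemLp (Y n) 2 μ)
    (h : ∀ ψ, MemLp ψ 2 μ →
      Tendsto (fun n => ∫ x, Y n x * ψ x ∂μ) atTop (𝓝 (∫ x, Y' x * ψ x ∂μ))) :
    ∃ M : ℝ, ∀ n, ‖(hY n).toLp (Y n)‖ ≤ M := by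
  have key : ∃ M, ∀ n, ‖innerSL ℝ ((hY n).toLp (Y n))‖ ≤ M := by
    apply banach_steinhaus
    intro z
    have hz := h z (Lp.memLp z)
    obtain ⟨C, hC⟩ := (Metric.isBounded_range_of_tendsto _ hz).exists_norm_le
    refine ⟨C, fun n => ?_⟩
    have : innerSL ℝ ((hY n).toLp (Y n)) z = ∫ x, Y n x * z x ∂μ := by
      rw [innerSL_apply_apply, ← inner_toLp_eq_integral (hY n) (Lp.memLp z), Lp.toLp_coeFn]
    rw [this]
    exact hC _ ⟨n, rfl⟩
  obtain ⟨M, hM⟩ := key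
  exact ⟨M, fun n => by simpa using hM n⟩

/-- The product of a weakly and a strongly convergent sequence in `L²` converges in the mean. -/
lemma tendsto_integral_mul_of_weak_of_strong {Y : ℕ → α → ℝ} {Y' : α → ℝ}
    (hY : ∀ n, MemLp (Y n) 2 μ)
    (h : ∀ ψ, MemLp ψ 2 μ →
      Tendsto (fun n => ∫ x, Y n x * ψ x ∂μ) atTop (𝓝 (∫ x, Y' x * ψ x ∂μ)))
    {f : ℕ → α → ℝ} {f' : α → ℝ} (hf : ∀ n, MemLp (f n) 2 μ) (hf' : MemLp f' 2 μ)
    (hff : Tendsto (fun n => eLpNorm (f n - f') 2 μ) atTop (𝓝 0)) :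
    Tendsto (fun n => ∫ x, Y n x * f n x ∂μ) atTop (𝓝 (∫ x, Y' x * f' x ∂μ)) := by
  obtain ⟨M, hM⟩ := exists_eLpNorm_le_of_weak_tendsto hY h
  have e : ∀ n, ∫ x, Y n x * f n x ∂μ =
      ∫ x, Y n x * f' x ∂μ + inner ℝ ((hY n).toLp (Y n)) (((hf n).sub hf').toLp (f n - f')) := by
    intro n
    rw [inner_toLp_eq_integral]
    refine Eq.trans ?_
      (integral_add ((hY n).integrable_mul hf') ((hY n).integrable_mul ((hf n).sub hf')))
    congr 1 with x
    simp only [Pi.sub_apply]; ring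
  simp_rw [e]
  have h0 : Tendsto (fun n => M * (eLpNorm (f n - f') 2 μ).toReal) atTop (𝓝 0) := by
    have := ((ENNReal.tendsto_toReal ENNReal.zero_ne_top).comp hff).const_mul M
    simpa using this
  have h1 : Tendsto (fun n => inner ℝ ((hY n).toLp (Y n)) (((hf n).sub hf').toLp (f n - f')))
      atTop (𝓝 0) := by
    refine squeeze_zero_norm (fun n => ?_) h0
    refine (norm_inner_le_norm _ _).trans ?_
    rw [Lp.norm_toLp (f n - f')]
    gcongr
    exact hM n
  simpa using (h f' hf').add h1

lemma tendsto_eLpNorm_two_of_tendsto_lintegral {α ι E : Type*} [MeasurableSpace α] {μ : Measure α}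
    [NormedAddCommGroup E] {l : Filter ι} {f : ι → α → E}
    (h : Tendsto (fun n => ∫⁻ x, ‖f n x‖ₑ ^ (2 : ℝ) ∂μ) l (𝓝 0)) :
    Tendsto (fun n => eLpNorm (f n) 2 μ) l (𝓝 0) := by
  simp_rw [eLpNorm_eq_lintegral_rpow_enorm_toReal (two_ne_zero) (ENNReal.ofNat_ne_top)]
  have := (ENNReal.continuous_rpow_const (y := (1 / 2 : ℝ))).tendsto 0 |>.comp h
  simpa [Function.comp_def] using this

/-- Dominated convergence in `L²` over a finite measure space, with a constant bound. -/
lemma tendsto_eLpNorm_two_of_bounded [IsFiniteMeasure μ] {f : ℕ → α → ℝ} {f' : α → ℝ}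
    (hf : ∀ n, AEStronglyMeasurable (f n) μ) (hf' : AEStronglyMeasurable f' μ) {K : ℝ}
    (hK : ∀ n, ∀ᵐ x ∂μ, |f n x| ≤ K)
    (h : ∀ᵐ x ∂μ, Tendsto (fun n => f n x) atTop (𝓝 (f' x))) :
    Tendsto (fun n => eLpNorm (f n - f') 2 μ) atTop (𝓝 0) := by
  have hb : ∀ᵐ x ∂μ, ∀ n, |f n x| ≤ K := ae_all_iff.2 hK
  have h1 : Tendsto (fun n => ∫⁻ x, ‖f n x - f' x‖ₑ ^ (2 : ℝ) ∂μ) atTop (𝓝 (∫⁻ _, 0 ∂μ)) := by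
    refine tendsto_lintegral_of_dominated_convergence'
      (fun _ => ENNReal.ofReal (2 * K) ^ (2 : ℝ)) (fun n => ?_) (fun n => ?_) ?_ ?_
    · exact (((hf n).sub hf').enorm).pow_const _
    · filter_upwards [hb, h] with x hx hx2
      have : |f' x| ≤ K := le_of_tendsto hx2.abs (Eventually.of_forall hx)
      refine ENNReal.rpow_le_rpow ?_ (by norm_num)
      rw [Real.enorm_eq_ofReal_abs]
      refine ENNReal.ofReal_le_ofReal ?_
      calc |f n x - f' x| ≤ |f n x| + |f' x| := abs_sub _ _
        _ ≤ 2 * K := by linarith [hx n]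
    · rw [lintegral_const]
      exact ENNReal.mul_ne_top (by finiteness) (measure_ne_top _ _)
    · filter_upwards [h] with x hx
      have h2 : Tendsto (fun n => ‖f n x - f' x‖ₑ) atTop (𝓝 0) := by
        have := (hx.sub_const (f' x)).enorm
        simpa using this
      have := (ENNReal.continuous_rpow_const (y := 2)).tendsto 0 |>.comp h2
      simpa [Function.comp_def] using this
  rw [lintegral_zero] at h1
  exact tendsto_eLpNorm_two_of_tendsto_lintegral h1

lemma integral_le_toReal_lintegral_ofReal {f : α → ℝ} (hf : Integrable f μ) :
    ∫ x, f x ∂μ ≤ (∫⁻ x, ENNReal.ofReal (f x) ∂μ).toReal := by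
  rw [integral_eq_lintegral_pos_part_sub_lintegral_neg_part hf]
  linarith [ENNReal.toReal_nonneg (a := ∫⁻ x, ENNReal.ofReal (-f x) ∂μ)]

section LowerSemicontinuity

variable {ι : Type*} [Fintype ι] [IsFiniteMeasure μ]
  {A Y : ℕ → ι → α → ℝ} {A' Y' : ι → α → ℝ} {B : ℕ → α → ℝ} {B' : α → ℝ} {c : ℝ≥0∞}

/-- The convexity inequality `2 a φ - φ² ≤ a²`, integrated and passed to the limit against test
functions `φₙ` for which all products with the strongly converging coefficients stay bounded. -/
lemma integral_two_mul_sub_sq_le {φ : ℕ → α → ℝ} {φ' : α → ℝ} {K : ℝ}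
    (hA : ∀ n i, AEStronglyMeasurable (A n i) μ) (hA' : ∀ i, AEStronglyMeasurable (A' i) μ)
    (hB : ∀ n, AEStronglyMeasurable (B n) μ) (hB' : AEStronglyMeasurable B' μ)
    (hφ : ∀ n, AEStronglyMeasurable (φ n) μ) (hφ' : AEStronglyMeasurable φ' μ)
    (hY : ∀ n i, MemLp (Y n i) 2 μ) (hY' : ∀ i, MemLp (Y' i) 2 μ)
    (hw : ∀ i ψ, MemLp ψ 2 μ →
      Tendsto (fun n => ∫ x, Y n i x * ψ x ∂μ) atTop (𝓝 (∫ x, Y' i x * ψ x ∂μ)))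
    (hAlim : ∀ i, ∀ᵐ x ∂μ, Tendsto (fun n => A n i x) atTop (𝓝 (A' i x)))
    (hBlim : ∀ᵐ x ∂μ, Tendsto (fun n => B n x) atTop (𝓝 (B' x)))
    (hφlim : ∀ᵐ x ∂μ, Tendsto (fun n => φ n x) atTop (𝓝 (φ' x)))
    (hφK : ∀ n x, |φ n x| ≤ K) (hAK : ∀ n i x, |A n i x * φ n x| ≤ K)
    (hBK : ∀ n x, |B n x * φ n x| ≤ K) (hc : c ≠ ⊤)
    (h : ∀ n, ∫⁻ x, ENNReal.ofReal ((∑ i, A n i x * Y n i x + B n x) ^ 2) ∂μ ≤ c) :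
    ∫ x, (2 * (∑ i, A' i x * Y' i x + B' x) * φ' x - φ' x ^ 2) ∂μ ≤ c.toReal := by
  have bdd {f : α → ℝ} (hf : AEStronglyMeasurable f μ) (hb : ∀ᵐ x ∂μ, |f x| ≤ K) :
      MemLp f 2 μ := MemLp.of_bound hf K (by simpa using hb)
  have limbdd {f : ℕ → α → ℝ} {f' : α → ℝ} (hb : ∀ n x, |f n x| ≤ K)
      (hl : ∀ᵐ x ∂μ, Tendsto (fun n => f n x) atTop (𝓝 (f' x))) : ∀ᵐ x ∂μ, |f' x| ≤ K := by
    filter_upwards [hl] with x hx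
    exact le_of_tendsto hx.abs (Eventually.of_forall fun n => hb n x)
  have hAφlim i : ∀ᵐ x ∂μ, Tendsto (fun n => A n i x * φ n x) atTop (𝓝 (A' i x * φ' x)) := by
    filter_upwards [hAlim i, hφlim] with x h1 h2 using h1.mul h2
  have hBφlim : ∀ᵐ x ∂μ, Tendsto (fun n => B n x * φ n x) atTop (𝓝 (B' x * φ' x)) := by
    filter_upwards [hBlim, hφlim] with x h1 h2 using h1.mul h2
  have mAφ n i : MemLp (fun x => A n i x * φ n x) 2 μ :=
    bdd ((hA n i).mul (hφ n)) (Eventually.of_forall (hAK n i))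
  have mAφ' i : MemLp (fun x => A' i x * φ' x) 2 μ :=
    bdd ((hA' i).mul hφ') (limbdd (fun n => hAK n i) (hAφlim i))
  have mBφ n : MemLp (fun x => B n x * φ n x) 2 μ :=
    bdd ((hB n).mul (hφ n)) (Eventually.of_forall (hBK n))
  have mBφ' : MemLp (fun x => B' x * φ' x) 2 μ := bdd (hB'.mul hφ') (limbdd hBK hBφlim)
  have mφ n : MemLp (φ n) 2 μ := bdd (hφ n) (Eventually.of_forall (hφK n))
  have mφ' : MemLp φ' 2 μ := bdd hφ' (limbdd hφK hφlim)
  have expand (A Y : ι → α → ℝ) (B φ : α → ℝ) (mAφ : ∀ i, MemLp (fun x => A i x * φ x) 2 μ)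
      (mY : ∀ i, MemLp (Y i) 2 μ) (mBφ : MemLp (fun x => B x * φ x) 2 μ) (mφ : MemLp φ 2 μ) :
      Integrable (fun x => 2 * (∑ i, A i x * Y i x + B x) * φ x - φ x ^ 2) μ ∧
      ∫ x, (2 * (∑ i, A i x * Y i x + B x) * φ x - φ x ^ 2) ∂μ =
        2 * (∑ i, ∫ x, Y i x * (A i x * φ x) ∂μ + ∫ x, B x * φ x ∂μ) - ∫ x, φ x ^ 2 ∂μ := by
    have i1 i : Integrable (fun x => Y i x * (A i x * φ x)) μ := (mY i).integrable_mul (mAφ i)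
    have i2 : Integrable (fun x => B x * φ x) μ := mBφ.integrable one_le_two
    have i3 : Integrable (fun x => φ x ^ 2) μ := mφ.integrable_sq
    have i4 : Integrable (fun x => ∑ i, Y i x * (A i x * φ x)) μ :=
      integrable_finsetSum _ fun i _ => i1 i
    have i5 : Integrable (fun x => ∑ i, Y i x * (A i x * φ x) + B x * φ x) μ := i4.add i2
    have e : (fun x => 2 * (∑ i, A i x * Y i x + B x) * φ x - φ x ^ 2) =
        fun x => 2 * (∑ i, Y i x * (A i x * φ x) + B x * φ x) - φ x ^ 2 := by
      ext x
      have : ∑ i, Y i x * (A i x * φ x) = (∑ i, A i x * Y i x) * φ x := by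
        rw [Finset.sum_mul]
        exact Finset.sum_congr rfl fun i _ => by ring
      rw [this]; ring
    rw [e]
    refine ⟨(i5.const_mul 2).sub i3, ?_⟩
    rw [integral_sub (i5.const_mul 2) i3, integral_const_mul, integral_add i4 i2,
      integral_finsetSum _ fun i _ => i1 i]
  have hlim : Tendsto (fun n => ∫ x, (2 * (∑ i, A n i x * Y n i x + B n x) * φ n x - φ n x ^ 2) ∂μ)
      atTop (𝓝 (∫ x, (2 * (∑ i, A' i x * Y' i x + B' x) * φ' x - φ' x ^ 2) ∂μ)) := by
    simp_rw [fun n => (expand (A n) (Y n) (B n) (φ n) (mAφ n) (hY n) (mBφ n) (mφ n)).2,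
      (expand A' Y' B' φ' mAφ' hY' mBφ' mφ').2]
    refine (((tendsto_finsetSum _ fun i _ => ?_).add ?_).const_mul 2).sub ?_
    · exact tendsto_integral_mul_of_weak_of_strong (fun n => hY n i) (hw i) (fun n => mAφ n i)
        (mAφ' i) (tendsto_eLpNorm_two_of_bounded (fun n => (mAφ n i).1) (mAφ' i).1
          (fun n => Eventually.of_forall (hAK n i)) (hAφlim i))
    · refine tendsto_integral_of_dominated_convergence (fun _ => K) (fun n => (mBφ n).1)
        (integrable_const _) (fun n => ?_) hBφlim
      exact Eventually.of_forall (hBK n)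
    · refine tendsto_integral_of_dominated_convergence (fun _ => K ^ 2)
        (fun n => (mφ n).integrable_sq.1) (integrable_const _) (fun n => ?_) ?_
      · refine Eventually.of_forall fun x => ?_
        rw [norm_pow]
        exact pow_le_pow_left₀ (norm_nonneg _) (hφK n x) 2
      · filter_upwards [hφlim] with x hx using hx.pow 2
  refine le_of_tendsto hlim (Eventually.of_forall fun n => ?_)
  refine (integral_le_toReal_lintegral_ofReal
    (expand (A n) (Y n) (B n) (φ n) (mAφ n) (hY n) (mBφ n) (mφ n)).1).trans ?_
  refine ENNReal.toReal_mono hc (le_trans (lintegral_mono fun x => ?_) (h n))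
  refine ENNReal.ofReal_le_ofReal ?_
  nlinarith [sq_nonneg (∑ i, A n i x * Y n i x + B n x - φ n x)]

/-- Weak lower semicontinuity of `∫ (∑ᵢ Aᵢ Yᵢ + B)²` when the coefficients `A`, `B` converge almost
everywhere and the arguments `Y` converge weakly in `L²`. No bound on the coefficients is needed,
since the test functions vanish where the coefficients are large or far from their limits. -/
lemma lintegral_sq_le_of_weak_tendsto
    (hA : ∀ n i, AEStronglyMeasurable (A n i) μ) (hA' : ∀ i, AEStronglyMeasurable (A' i) μ)
    (hB : ∀ n, AEStronglyMeasurable (B n) μ) (hB' : AEStronglyMeasurable B' μ)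
    (hY : ∀ n i, MemLp (Y n i) 2 μ) (hY' : ∀ i, MemLp (Y' i) 2 μ)
    (hw : ∀ i ψ, MemLp ψ 2 μ →
      Tendsto (fun n => ∫ x, Y n i x * ψ x ∂μ) atTop (𝓝 (∫ x, Y' i x * ψ x ∂μ)))
    (hAlim : ∀ i, ∀ᵐ x ∂μ, Tendsto (fun n => A n i x) atTop (𝓝 (A' i x)))
    (hBlim : ∀ᵐ x ∂μ, Tendsto (fun n => B n x) atTop (𝓝 (B' x))) (hc : c ≠ ⊤)
    (h : ∀ n, ∫⁻ x, ENNReal.ofReal ((∑ i, A n i x * Y n i x + B n x) ^ 2) ∂μ ≤ c) :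
    ∫⁻ x, ENNReal.ofReal ((∑ i, A' i x * Y' i x + B' x) ^ 2) ∂μ ≤ c := by
  set a : α → ℝ := fun x => ∑ i, A' i x * Y' i x + B' x with ha
  set S : α → ℝ := fun x => ∑ i, |A' i x| + ∑ i, |Y' i x| + |B' x| with hS
  set D : ℕ → α → ℝ := fun n x => ∑ i, |A n i x - A' i x| + |B n x - B' x| with hD
  -- `cut r t` is `1` if `t ≤ r` and `0` otherwise.
  set cut : ℝ → ℝ → ℝ := fun r => (Set.Iic r).indicator 1 with hcut
  have cut_meas r : Measurable (cut r) := measurable_one.indicator measurableSet_Iic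
  have cut_of_le {r t : ℝ} (htr : t ≤ r) : cut r t = 1 := by simp [hcut, htr]
  have cut_of_lt {r t : ℝ} (htr : r < t) : cut r t = 0 := by simp [hcut, htr]
  have hYm i := (hY' i).1
  have a_meas : AEMeasurable a μ := by
    refine AEMeasurable.add (Finset.aemeasurable_fun_sum _ fun i _ => ?_) hB'.aemeasurable
    exact (hA' i).aemeasurable.mul (hYm i).aemeasurable
  have S_meas : AEMeasurable S μ := by
    refine ((Finset.aemeasurable_fun_sum _ fun i _ => ?_).add
      (Finset.aemeasurable_fun_sum _ fun i _ => ?_)).add hB'.aemeasurable.abs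
    · exact (hA' i).aemeasurable.abs
    · exact (hYm i).aemeasurable.abs
  have D_meas n : AEMeasurable (D n) μ := by
    refine (Finset.aemeasurable_fun_sum _ fun i _ => ?_).add
      ((hB n).aemeasurable.sub hB'.aemeasurable).abs
    exact ((hA n i).aemeasurable.sub (hA' i).aemeasurable).abs
  have sA x : 0 ≤ ∑ i, |A' i x| := Finset.sum_nonneg fun _ _ => abs_nonneg _
  have sY x : 0 ≤ ∑ i, |Y' i x| := Finset.sum_nonneg fun _ _ => abs_nonneg _
  have A_le i x : |A' i x| ≤ S x := by
    have := Finset.single_le_sum (f := fun i => |A' i x|) (fun _ _ => abs_nonneg _)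
      (Finset.mem_univ i)
    have h2 := abs_nonneg (B' x)
    simp only [hS] at *
    linarith [sY x]
  have B_le x : |B' x| ≤ S x := by simp only [hS]; linarith [sY x, sA x]
  have AD_le n i x : |A n i x - A' i x| ≤ D n x := by
    have := Finset.single_le_sum (f := fun i => |A n i x - A' i x|) (fun _ _ => abs_nonneg _)
      (Finset.mem_univ i)
    have h2 := abs_nonneg (B n x - B' x)
    simp only [hD] at *
    linarith
  have BD_le n x : |B n x - B' x| ≤ D n x := by
    have : 0 ≤ ∑ i, |A n i x - A' i x| := Finset.sum_nonneg fun _ _ => abs_nonneg _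
    simp only [hD]; linarith
  have a_le x : |a x| ≤ S x ^ 2 + S x := by
    have h1 : |∑ i, A' i x * Y' i x| ≤ (∑ i, |A' i x|) * ∑ i, |Y' i x| := by
      rw [Finset.sum_mul]
      refine (Finset.abs_sum_le_sum_abs _ _).trans (Finset.sum_le_sum fun i _ => ?_)
      rw [abs_mul]
      gcongr
      exact Finset.single_le_sum (f := fun i => |Y' i x|) (fun _ _ => abs_nonneg _)
        (Finset.mem_univ i)
    have h2 : |a x| ≤ |∑ i, A' i x * Y' i x| + |B' x| := abs_add_le _ _
    have h3 := sA x
    have h4 := sY x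
    have h5 := abs_nonneg (B' x)
    simp only [hS]
    nlinarith [mul_nonneg h3 h4, mul_nonneg h3 h5, mul_nonneg h4 h5]
  have D_lim : ∀ᵐ x ∂μ, Tendsto (fun n => D n x) atTop (𝓝 0) := by
    filter_upwards [ae_all_iff.2 hAlim, hBlim] with x h1 h2
    have h3 : Tendsto (fun n => ∑ i, |A n i x - A' i x|) atTop (𝓝 (∑ i : ι, (0 : ℝ))) := by
      refine tendsto_finsetSum _ fun i _ => ?_
      simpa using ((h1 i).sub_const (A' i x)).abs
    have h4 : Tendsto (fun n => |B n x - B' x|) atTop (𝓝 0) := by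
      simpa using (h2.sub_const (B' x)).abs
    simpa [hD] using h3.add h4
  have main (N : ℕ) : ∫⁻ x, ENNReal.ofReal ((a x * cut N (S x)) ^ 2) ∂μ ≤ c := by
    -- Where `S ≤ N` and `D n ≤ 1`, `|a| ≤ N² + N` and the coefficients are at most `N + 1`.
    set K : ℝ := ((N : ℝ) ^ 2 + N) * (N + 2) with hK
    have hN : (0 : ℝ) ≤ N := N.cast_nonneg
    have hφN x : |a x * cut N (S x)| ≤ (N : ℝ) ^ 2 + N := by
      rcases le_or_gt (S x) N with hx | hx
      · rw [cut_of_le hx, mul_one]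
        have h0 : 0 ≤ S x := (abs_nonneg _).trans (B_le x)
        nlinarith [a_le x]
      · rw [cut_of_lt hx]; simp; positivity
    have key := integral_two_mul_sub_sq_le (K := K) (c := c)
      (φ := fun n x => a x * cut N (S x) * cut 1 (D n x)) (φ' := fun x => a x * cut N (S x))
      hA hA' hB hB'
      (fun n => ((a_meas.mul ((cut_meas _).comp_aemeasurable S_meas)).mul
        ((cut_meas _).comp_aemeasurable (D_meas n))).aestronglyMeasurable)
      (a_meas.mul ((cut_meas _).comp_aemeasurable S_meas)).aestronglyMeasurable
      hY hY' hw hAlim hBlim ?_ ?_ ?_ ?_ hc h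
    · have hsq x : 2 * (∑ i, A' i x * Y' i x + B' x) * (a x * cut N (S x)) -
          (a x * cut N (S x)) ^ 2 = (a x * cut N (S x)) ^ 2 := by
        change 2 * a x * (a x * cut N (S x)) - _ = _
        rcases le_or_gt (S x) N with hx | hx
        · rw [cut_of_le hx]; ring
        · rw [cut_of_lt hx]; ring
      simp_rw [hsq] at key
      rw [← ofReal_integral_eq_lintegral_ofReal]
      · exact ENNReal.ofReal_le_of_le_toReal key
      · refine MemLp.integrable_sq (MemLp.of_bound
          (a_meas.mul ((cut_meas _).comp_aemeasurable S_meas)).aestronglyMeasurable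
          ((N : ℝ) ^ 2 + N) (Eventually.of_forall hφN))
      · exact Eventually.of_forall fun x => sq_nonneg _
    · filter_upwards [D_lim] with x hx
      refine Tendsto.congr' ?_ tendsto_const_nhds
      filter_upwards [hx.eventually (ge_mem_nhds zero_lt_one)] with n hn
      rw [cut_of_le hn, mul_one]
    · intro n x
      have h1 := hφN x
      rcases le_or_gt (D n x) 1 with hx | hx
      · rw [cut_of_le hx, mul_one]
        refine h1.trans ?_
        rw [hK]
        exact le_mul_of_one_le_right (by positivity) (by linarith)
      · rw [cut_of_lt hx]; simp; positivity
    · intro n i x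
      rcases le_or_gt (D n x) 1 with hx | hx
      · rcases le_or_gt (S x) N with hx2 | hx2
        · rw [cut_of_le hx, mul_one, abs_mul, mul_comm, hK]
          refine mul_le_mul (hφN x) ?_ (abs_nonneg _) (by positivity)
          have := abs_add_le (A n i x - A' i x) (A' i x)
          rw [sub_add_cancel] at this
          linarith [AD_le n i x, A_le i x]
        · rw [cut_of_lt hx2]; simp; positivity
      · rw [cut_of_lt hx]; simp; positivity
    · intro n x
      rcases le_or_gt (D n x) 1 with hx | hx
      · rcases le_or_gt (S x) N with hx2 | hx2
        · rw [cut_of_le hx, mul_one, abs_mul, mul_comm, hK]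
          refine mul_le_mul (hφN x) ?_ (abs_nonneg _) (by positivity)
          have := abs_add_le (B n x - B' x) (B' x)
          rw [sub_add_cancel] at this
          linarith [BD_le n x, B_le x]
        · rw [cut_of_lt hx2]; simp; positivity
      · rw [cut_of_lt hx]; simp; positivity
  have hlim x : ENNReal.ofReal (a x ^ 2) =
      liminf (fun N : ℕ => ENNReal.ofReal ((a x * cut N (S x)) ^ 2)) atTop := by
    refine (Tendsto.liminf_eq ?_).symm
    refine Tendsto.congr' ?_ tendsto_const_nhds
    obtain ⟨N, hN⟩ := exists_nat_ge (S x)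
    filter_upwards [eventually_ge_atTop N] with m hm
    rw [cut_of_le (hN.trans (by exact_mod_cast hm)), mul_one]
  change ∫⁻ x, ENNReal.ofReal (a x ^ 2) ∂μ ≤ c
  rw [lintegral_congr hlim]
  refine (lintegral_liminf_le' fun N => ?_).trans ?_
  · exact ((a_meas.mul ((cut_meas _).comp_aemeasurable S_meas)).pow_const 2).ennreal_ofReal
  · exact liminf_le_of_frequently_le' (Eventually.of_forall main).frequently

end LowerSemicontinuity

end WeakConvergence

/-! ### Plancherel's theorem and weak derivatives -/

section Fourier

open FourierTransform SchwartzMap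

/-- Plancherel's theorem for the Fourier integral of a function in `L¹ ∩ L²`. -/
lemma eLpNorm_fourier_two {V : Type*} [NormedAddCommGroup V] [InnerProductSpace ℝ V]
    [FiniteDimensional ℝ V] [MeasurableSpace V] [BorelSpace V] {f : V → ℂ}
    (h1 : Integrable f) (h2 : MemLp f 2) : eLpNorm (𝓕 f) 2 volume = eLpNorm f 2 volume := by
  have hcont : Continuous (𝓕 f) :=
    VectorFourier.fourierIntegral_continuous Real.continuous_fourierChar
      (innerSL ℝ).continuous₂ h1
  have hae : ∀ᵐ x, (𝓕 (h2.toLp f) : Lp ℂ 2 (volume : Measure V)) x = 𝓕 f x := by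
    refine ae_eq_of_integral_contDiff_smul_eq
      ((Lp.memLp _).locallyIntegrable one_le_two) hcont.locallyIntegrable fun g hg hgc => ?_
    have hg₁ : HasCompactSupport (Complex.ofRealCLM ∘ g) := hgc.comp_left rfl
    have hg₂ : ContDiff ℝ ∞ (Complex.ofRealCLM ∘ g) := by fun_prop
    set G : 𝓢(V, ℂ) := hg₁.toSchwartzMap hg₂
    have hG x : G x = (g x : ℂ) := rfl
    calc ∫ x, g x • (𝓕 (h2.toLp f) : Lp ℂ 2 (volume : Measure V)) x
        = Lp.toTemperedDistribution (𝓕 (h2.toLp f) : Lp ℂ 2 (volume : Measure V)) G := by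
          rw [Lp.toTemperedDistribution_apply]; rfl
      _ = Lp.toTemperedDistribution (h2.toLp f) (𝓕 G) := by
          rw [← Lp.fourier_toTemperedDistribution_eq, TemperedDistribution.fourier_apply]
      _ = ∫ x, 𝓕 (G : V → ℂ) x • f x := by
          rw [Lp.toTemperedDistribution_apply]
          apply integral_congr_ae
          filter_upwards [h2.coeFn_toLp] with x hx
          rw [hx, SchwartzMap.fourier_coe]
      _ = ∫ x, G x • 𝓕 f x := by
          have := VectorFourier.integral_fourierIntegral_smul_eq_flip (μ := (volume : Measure V))
            (ν := (volume : Measure V)) (L := innerₗ V) Real.continuous_fourierChar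
            continuous_inner G.integrable h1
          rw [flip_innerₗ] at this
          exact this
      _ = ∫ x, g x • 𝓕 f x := rfl
  rw [← eLpNorm_congr_ae hae]
  have e := Lp.norm_fourier_eq (h2.toLp f)
  rw [Lp.norm_toLp, Lp.norm_def] at e
  exact (ENNReal.toReal_eq_toReal_iff' (Lp.eLpNorm_ne_top _) h2.eLpNorm_ne_top).1 e

lemma fourier_ofReal_eq {f : Plane → ℝ} (hf : Integrable f) (ξ : Plane) :
    𝓕 (fun x => (f x : ℂ)) ξ =
      ((∫ v, f v * Real.cos (2 * Real.pi * inner ℝ v ξ) : ℝ) : ℂ) -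
      ((∫ v, f v * Real.sin (2 * Real.pi * inner ℝ v ξ) : ℝ) : ℂ) * Complex.I := by
  have i1 : Integrable fun v => f v * Real.cos (2 * Real.pi * inner ℝ v ξ) :=
    hf.mul_bdd (c := 1) (by fun_prop) (Eventually.of_forall fun x => Real.abs_cos_le_one _)
  have i2 : Integrable fun v => f v * Real.sin (2 * Real.pi * inner ℝ v ξ) :=
    hf.mul_bdd (c := 1) (by fun_prop) (Eventually.of_forall fun x => Real.abs_sin_le_one _)
  rw [Real.fourier_eq', ← integral_complex_ofReal, ← integral_complex_ofReal,
    ← integral_mul_const, ← integral_sub i1.ofReal (i2.ofReal.mul_const _)]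
  congr 1 with v
  rw [Complex.exp_mul_I, ← Complex.ofReal_cos, ← Complex.ofReal_sin]
  have : (-2 * Real.pi * inner ℝ v ξ : ℝ) = -(2 * Real.pi * inner ℝ v ξ) := by ring
  rw [this, Real.cos_neg, Real.sin_neg]
  push_cast
  simp only [smul_eq_mul]
  ring

/-- The Fourier transform turns a weak partial derivative into multiplication by `2πi ξᵢ`. The
test functions are the real and imaginary parts of the characters, hence the hypothesis for test
functions without compact support. -/
lemma fourier_weak_partial {f f' : Plane → ℝ} (hf : Integrable f) (hf' : Integrable f') {i : Fin 2}
    (h : ∀ φ : Plane → ℝ, ContDiff ℝ ∞ φ →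
      ∫ w, f w * fderiv ℝ φ w (EuclideanSpace.single i 1) = - ∫ w, f' w * φ w) (ξ : Plane) :
    𝓕 (fun x => (f' x : ℂ)) ξ = (2 * Real.pi * ξ i) * Complex.I * 𝓕 (fun x => (f x : ℂ)) ξ := by
  have hlin (w : Plane) : HasFDerivAt (fun v : Plane => 2 * Real.pi * inner ℝ v ξ)
      ((2 * Real.pi) • innerSL ℝ ξ) w := by
    have := ((innerSL ℝ ξ).hasFDerivAt (x := w)).const_mul (2 * Real.pi)
    refine this.congr_of_eventuallyEq (Eventually.of_forall fun v => ?_)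
    simp [real_inner_comm]
  have hsmooth : ContDiff ℝ ∞ fun v : Plane => 2 * Real.pi * inner ℝ v ξ :=
    contDiff_const.mul (contDiff_id.inner ℝ contDiff_const)
  have he : inner ℝ ξ (EuclideanSpace.single i (1 : ℝ)) = ξ i := by
    rw [real_inner_comm, EuclideanSpace.inner_single_left]; simp
  have hc := h (fun v => Real.cos (2 * Real.pi * inner ℝ v ξ)) hsmooth.cos
  have hs := h (fun v => Real.sin (2 * Real.pi * inner ℝ v ξ)) hsmooth.sin
  have ec : ∫ w, f w * fderiv ℝ (fun v => Real.cos (2 * Real.pi * inner ℝ v ξ)) w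
      (EuclideanSpace.single i 1) =
      -(2 * Real.pi * ξ i) * ∫ w, f w * Real.sin (2 * Real.pi * inner ℝ w ξ) := by
    rw [← integral_const_mul]
    congr 1 with w
    rw [(hlin w).cos.fderiv]
    simp only [smul_apply, innerSL_apply_apply, he, smul_eq_mul]
    ring
  have es : ∫ w, f w * fderiv ℝ (fun v => Real.sin (2 * Real.pi * inner ℝ v ξ)) w
      (EuclideanSpace.single i 1) =
      (2 * Real.pi * ξ i) * ∫ w, f w * Real.cos (2 * Real.pi * inner ℝ w ξ) := by
    rw [← integral_const_mul]
    congr 1 with w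
    rw [(hlin w).sin.fderiv]
    simp only [smul_apply, innerSL_apply_apply, he, smul_eq_mul]
    ring
  rw [ec] at hc
  rw [es] at hs
  have hc' : ∫ w, f' w * Real.cos (2 * Real.pi * inner ℝ w ξ) =
      (2 * Real.pi * ξ i) * ∫ w, f w * Real.sin (2 * Real.pi * inner ℝ w ξ) := by linarith
  have hs' : ∫ w, f' w * Real.sin (2 * Real.pi * inner ℝ w ξ) =
      -((2 * Real.pi * ξ i) * ∫ w, f w * Real.cos (2 * Real.pi * inner ℝ w ξ)) := by linarith
  rw [fourier_ofReal_eq hf, fourier_ofReal_eq hf', hc', hs']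
  push_cast
  linear_combination ((2 * Real.pi * ξ i : ℂ) *
    (∫ w, f w * Real.sin (2 * Real.pi * inner ℝ w ξ) : ℝ)) * Complex.I_sq

end Fourier

/-! ### Rellich's theorem for functions with support in a ball -/

section Compactness

open FourierTransform

lemma lintegral_enorm_rpow_two {α E : Type*} [MeasurableSpace α] {μ : Measure α}
    [NormedAddCommGroup E] (f : α → E) : ∫⁻ x, ‖f x‖ₑ ^ (2 : ℝ) ∂μ = eLpNorm f 2 μ ^ (2 : ℝ) := by
  rw [eLpNorm_eq_lintegral_rpow_enorm_toReal (two_ne_zero) (ENNReal.ofNat_ne_top),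
    ← ENNReal.rpow_mul]
  norm_num

/-- Rellich's theorem for functions supported in a fixed ball. The Fourier transforms tend to `0`
pointwise and boundedly, and carry little mass outside large balls because the transforms of the
derivatives are bounded in `L²`. -/
lemma tendsto_eLpNorm_two_of_weak_of_support {f : ℕ → Plane → ℝ} {f' : ℕ → Fin 2 → Plane → ℝ}
    {ρ : ℝ} (hf : ∀ n, MemLp (f n) 2) (hf' : ∀ n i, MemLp (f' n i) 2)
    (hs : ∀ n, Function.support (f n) ⊆ Metric.ball 0 ρ)
    (hs' : ∀ n i, Function.support (f' n i) ⊆ Metric.ball 0 ρ)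
    (hder : ∀ n i (φ : Plane → ℝ), ContDiff ℝ ∞ φ →
      ∫ w, f n w * fderiv ℝ φ w (EuclideanSpace.single i 1) = - ∫ w, f' n i w * φ w)
    (hw : ∀ ψ : Plane → ℝ, MemLp ψ 2 → Tendsto (fun n => ∫ w, f n w * ψ w) atTop (𝓝 0))
    (hw' : ∀ i, ∀ ψ : Plane → ℝ, MemLp ψ 2 →
      Tendsto (fun n => ∫ w, f' n i w * ψ w) atTop (𝓝 0)) :
    Tendsto (fun n => eLpNorm (f n) 2 volume) atTop (𝓝 0) := by
  have hball : volume (Metric.ball (0 : Plane) ρ) ≠ ⊤ := measure_ball_lt_top.ne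
  have integrable_of {h : Plane → ℝ} (h2 : MemLp h 2) (hsupp : Function.support h ⊆ Metric.ball 0 ρ) :
      Integrable h := by
    rw [← memLp_one_iff_integrable]
    refine h2.mono_exponent_of_measure_support_ne_top (s := Metric.ball 0 ρ) (fun x hx => ?_)
      hball one_le_two
    by_contra hne
    exact hx (hsupp hne)
  have fi n := integrable_of (hf n) (hs n)
  have fi' n i := integrable_of (hf' n i) (hs' n i)
  obtain ⟨M, hM⟩ := exists_eLpNorm_le_of_weak_tendsto (Y' := 0) hf (by simpa using hw)
  have bdd' i := exists_eLpNorm_le_of_weak_tendsto (Y' := 0) (fun n => hf' n i)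
    (by simpa using hw' i)
  choose M' hM' using bdd'
  set Φ : ℕ → Plane → ℂ := fun n => 𝓕 (fun x => (f n x : ℂ)) with hΦ
  set Φ' : ℕ → Fin 2 → Plane → ℂ := fun n i => 𝓕 (fun x => (f' n i x : ℂ)) with hΦ'
  have Φ_cont n : Continuous (Φ n) :=
    VectorFourier.fourierIntegral_continuous Real.continuous_fourierChar
      (innerSL ℝ).continuous₂ (fi n).ofReal
  have Φ'_cont n i : Continuous (Φ' n i) :=
    VectorFourier.fourierIntegral_continuous Real.continuous_fourierChar
      (innerSL ℝ).continuous₂ (fi' n i).ofReal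
  have one_mem : MemLp ((Metric.ball (0 : Plane) ρ).indicator (1 : Plane → ℝ)) 2 :=
    memLp_indicator_const 2 measurableSet_ball (1 : ℝ) (Or.inr hball)
  have Φ_bdd : ∃ C : ℝ, ∀ n ξ, ‖Φ n ξ‖ ≤ C := by
    refine ⟨M * ‖one_mem.toLp _‖, fun n ξ => ?_⟩
    calc ‖Φ n ξ‖ ≤ ∫ x, ‖(f n x : ℂ)‖ :=
          VectorFourier.norm_fourierIntegral_le_integral_norm _ _ _ _ _
      _ = ∫ x, |f n x| * (Metric.ball (0 : Plane) ρ).indicator (1 : Plane → ℝ) x := by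
          congr 1 with x
          by_cases hx : x ∈ Metric.ball (0 : Plane) ρ
          · simp [Set.indicator_of_mem hx]
          · have : f n x = 0 := by_contra fun hne => hx (hs n hne)
            simp [this]
      _ = inner ℝ ((hf n).abs.toLp _) (one_mem.toLp _) := (inner_toLp_eq_integral _ _).symm
      _ ≤ ‖(hf n).abs.toLp _‖ * ‖one_mem.toLp _‖ := real_inner_le_norm _ _
      _ ≤ M * ‖one_mem.toLp _‖ := by
          gcongr
          refine le_trans (le_of_eq ?_) (hM n)
          rw [Lp.norm_toLp, Lp.norm_toLp]
          congr 1
          exact eLpNorm_norm (f n)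
  obtain ⟨C, hC⟩ := Φ_bdd
  have Φ_lim ξ : Tendsto (fun n => Φ n ξ) atTop (𝓝 0) := by
    have test (θ : Plane → ℝ) (hθ : Continuous θ) (hb : ∀ x, |θ x| ≤ 1) :
        Tendsto (fun n => ∫ v, f n v * θ v) atTop (𝓝 0) := by
      have hmem : MemLp ((Metric.ball (0 : Plane) ρ).indicator θ) 2 := by
        refine one_mem.mono (hθ.aestronglyMeasurable.indicator measurableSet_ball)
          (Eventually.of_forall fun x => ?_)
        by_cases hx : x ∈ Metric.ball (0 : Plane) ρ
        · simpa [Set.indicator_of_mem hx] using hb x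
        · simp [Set.indicator_of_notMem hx]
      refine (hw _ hmem).congr fun n => ?_
      congr 1 with x
      by_cases hx : x ∈ Metric.ball (0 : Plane) ρ
      · simp [Set.indicator_of_mem hx]
      · have : f n x = 0 := by_contra fun hne => hx (hs n hne)
        simp [this]
    have hcos := test (fun v => Real.cos (2 * Real.pi * inner ℝ v ξ)) (by fun_prop)
      fun x => Real.abs_cos_le_one _
    have hsin := test (fun v => Real.sin (2 * Real.pi * inner ℝ v ξ)) (by fun_prop)
      fun x => Real.abs_sin_le_one _
    simp only [hΦ, fun n => fourier_ofReal_eq (fi n) ξ]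
    have h1 := (Complex.continuous_ofReal.tendsto 0).comp hcos
    have h2 := ((Complex.continuous_ofReal.tendsto 0).comp hsin).mul_const Complex.I
    simpa [Function.comp_def] using h1.sub h2
  have Φ'_norm n : ∑ i, ∫⁻ ξ, ‖Φ' n i ξ‖ₑ ^ (2 : ℝ) ≤ ∑ i, ENNReal.ofReal (M' i) ^ (2 : ℝ) := by
    refine Finset.sum_le_sum fun i _ => ?_
    rw [lintegral_enorm_rpow_two, show eLpNorm (Φ' n i) 2 volume = _ from
      eLpNorm_fourier_two (fi' n i).ofReal (hf' n i).ofReal]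
    have e : eLpNorm (fun x => (f' n i x : ℂ)) 2 volume = eLpNorm (f' n i) 2 volume :=
      eLpNorm_congr_norm_ae (Eventually.of_forall fun x => by simp)
    rw [e]
    gcongr
    have := hM' i n
    rw [Lp.norm_toLp] at this
    exact ENNReal.le_ofReal_iff_toReal_le (hf' n i).eLpNorm_ne_top
      (ENNReal.toReal_nonneg.trans this) |>.2 this
  set Q : ℝ≥0∞ := ∑ i, ENNReal.ofReal (M' i) ^ (2 : ℝ) with hQ
  have Q_top : Q ≠ ⊤ := by
    refine ENNReal.sum_ne_top.2 fun i _ => by finiteness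
  -- Mass of the transforms outside the ball of radius `m + 1`.
  have split (n m : ℕ) : ∫⁻ ξ, ‖Φ n ξ‖ₑ ^ (2 : ℝ) ≤
      (∫⁻ ξ in Metric.ball 0 ((m : ℝ) + 1), ‖Φ n ξ‖ₑ ^ (2 : ℝ)) +
        ENNReal.ofReal (1 / ((m : ℝ) + 1)) * Q := by
    rw [← lintegral_add_compl _ (measurableSet_ball (x := (0 : Plane)) (ε := (m : ℝ) + 1))]
    gcongr
    calc ∫⁻ ξ in (Metric.ball 0 ((m : ℝ) + 1))ᶜ, ‖Φ n ξ‖ₑ ^ (2 : ℝ)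
        ≤ ∫⁻ ξ in (Metric.ball 0 ((m : ℝ) + 1))ᶜ,
            ENNReal.ofReal (1 / ((m : ℝ) + 1)) * ∑ i, ‖Φ' n i ξ‖ₑ ^ (2 : ℝ) := by
          refine setLIntegral_mono' measurableSet_ball.compl fun ξ hξ => ?_
          have hξ' : (m : ℝ) + 1 ≤ ‖ξ‖ := by simpa using hξ
          have hm : (0 : ℝ) ≤ m := m.cast_nonneg
          have conv (z : ℂ) : ‖z‖ₑ ^ (2 : ℝ) = ENNReal.ofReal (‖z‖ ^ 2) := by
            rw [← ofReal_norm, ENNReal.ofReal_rpow_of_nonneg (norm_nonneg _) (by norm_num)]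
            norm_num
          simp_rw [conv]
          rw [← ENNReal.ofReal_sum_of_nonneg fun i _ => by positivity,
            ← ENNReal.ofReal_mul (by positivity)]
          refine ENNReal.ofReal_le_ofReal ?_
          have hnorm i : ‖Φ' n i ξ‖ ^ 2 = (2 * Real.pi) ^ 2 * ξ i ^ 2 * ‖Φ n ξ‖ ^ 2 := by
            simp only [hΦ', hΦ]
            rw [fourier_weak_partial (fi n) (fi' n i) (hder n i) ξ]
            simp only [norm_mul, Complex.norm_I, Complex.norm_real, Complex.norm_ofNat, mul_one,
              mul_pow, Real.norm_eq_abs, sq_abs]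
          simp_rw [hnorm]
          rw [← Finset.sum_mul, ← Finset.mul_sum]
          have hsum : ∑ i, ξ i ^ 2 = ‖ξ‖ ^ 2 := by
            rw [EuclideanSpace.norm_sq_eq]; simp
          rw [hsum, div_mul_eq_mul_div, one_mul, le_div_iff₀ (by positivity), mul_comm]
          refine mul_le_mul_of_nonneg_right ?_ (by positivity)
          have h1 : (m : ℝ) + 1 ≤ ‖ξ‖ ^ 2 := by nlinarith
          have h2 : (1 : ℝ) ≤ (2 * Real.pi) ^ 2 := by nlinarith [Real.pi_gt_three]
          nlinarith
      _ ≤ ∫⁻ ξ, ENNReal.ofReal (1 / ((m : ℝ) + 1)) * ∑ i, ‖Φ' n i ξ‖ₑ ^ (2 : ℝ) :=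
          setLIntegral_le_lintegral _ _
      _ = ENNReal.ofReal (1 / ((m : ℝ) + 1)) * ∑ i, ∫⁻ ξ, ‖Φ' n i ξ‖ₑ ^ (2 : ℝ) := by
          have hm i : Measurable fun ξ => ‖Φ' n i ξ‖ₑ ^ (2 : ℝ) :=
            ((Φ'_cont n i).measurable.enorm).pow_const _
          rw [lintegral_const_mul _ (Finset.measurable_fun_sum _ fun i _ => hm i),
            lintegral_finsetSum _ fun i _ => hm i]
      _ ≤ ENNReal.ofReal (1 / ((m : ℝ) + 1)) * Q := by gcongr; exact Φ'_norm n
  have inner_lim (m : ℕ) :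
      Tendsto (fun n => ∫⁻ ξ in Metric.ball 0 ((m : ℝ) + 1), ‖Φ n ξ‖ₑ ^ (2 : ℝ)) atTop (𝓝 0) := by
    have := tendsto_lintegral_of_dominated_convergence
      (μ := volume.restrict (Metric.ball (0 : Plane) ((m : ℝ) + 1)))
      (F := fun n ξ => ‖Φ n ξ‖ₑ ^ (2 : ℝ)) (f := fun _ => 0)
      (fun _ => ENNReal.ofReal C ^ (2 : ℝ))
      (fun n => ((Φ_cont n).measurable.enorm).pow_const _)
      (fun n => Eventually.of_forall fun ξ => ?_) ?_ (Eventually.of_forall fun ξ => ?_)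
    · simpa using this
    · refine ENNReal.rpow_le_rpow ?_ (by norm_num)
      rw [← ofReal_norm]
      exact ENNReal.ofReal_le_ofReal (hC n ξ)
    · rw [lintegral_const]
      refine ENNReal.mul_ne_top (by finiteness) ?_
      rw [Measure.restrict_apply_univ]
      exact measure_ball_lt_top.ne
    · have h1 : Tendsto (fun n => ‖Φ n ξ‖ₑ) atTop (𝓝 0) := by simpa using (Φ_lim ξ).enorm
      have h2 := (ENNReal.continuous_rpow_const (y := (2 : ℝ))).tendsto 0 |>.comp h1
      simpa [Function.comp_def] using h2
  have outer_lim : Tendsto (fun m : ℕ => ENNReal.ofReal (1 / ((m : ℝ) + 1)) * Q) atTop (𝓝 0) := by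
    have h1 := ENNReal.tendsto_ofReal (tendsto_one_div_add_atTop_nhds_zero_nat (𝕜 := ℝ))
    simpa using ENNReal.Tendsto.mul_const h1 (Or.inr Q_top)
  have Φ_norm n : eLpNorm (Φ n) 2 volume = eLpNorm (f n) 2 volume := by
    refine (eLpNorm_fourier_two (fi n).ofReal (hf n).ofReal).trans ?_
    exact eLpNorm_congr_norm_ae (Eventually.of_forall fun x => by simp)
  simp_rw [← Φ_norm]
  refine tendsto_eLpNorm_two_of_tendsto_lintegral (ENNReal.tendsto_nhds_zero.2 fun ε hε => ?_)
  have hε2 : 0 < ε / 2 := ENNReal.half_pos hε.ne'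
  obtain ⟨m, hm⟩ := (ENNReal.tendsto_nhds_zero.1 outer_lim (ε / 2) hε2).exists
  filter_upwards [ENNReal.tendsto_nhds_zero.1 (inner_lim m) (ε / 2) hε2] with n hn
  exact (split n m).trans ((add_le_add hn hm).trans_eq (ENNReal.add_halves ε))

end Compactness

/-! ### Localization and Rellich's theorem -/

section Localization

lemma MemLpLoc.memLp_mul {u χ : Plane → ℝ} {p : ℝ≥0∞} (hu : MemLpLoc p u) (hχ : Continuous χ)
    (hc : HasCompactSupport χ) : MemLp (fun w => χ w * u w) p := by
  obtain ⟨ρ, hρ⟩ := hc.isBounded.subset_ball (0 : Plane)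
  obtain ⟨K, hK⟩ := hχ.bounded_above_of_compact_support hc
  have h1 : MemLp (fun w => χ w * u w) p (volume.restrict (Metric.ball 0 ρ)) := by
    refine (hu ρ).of_le_mul (c := K) (hχ.aestronglyMeasurable.mul (hu ρ).1)
      (Eventually.of_forall fun w => ?_)
    rw [norm_mul]
    gcongr
    exact hK w
  have h2 : (Metric.ball (0 : Plane) ρ).indicator (fun w => χ w * u w) = fun w => χ w * u w := by
    refine Set.indicator_eq_self.2 fun w hw => hρ (subset_tsupport _ fun h0 => hw ?_)
    simp [h0]
  rw [← h2]
  exact (memLp_indicator_iff_restrict measurableSet_ball).2 h1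

lemma MemLpLoc.sub {u v : Plane → ℝ} {p : ℝ≥0∞} (hu : MemLpLoc p u) (hv : MemLpLoc p v) :
    MemLpLoc p (fun w => u w - v w) := fun R => (hu R).sub (hv R)

lemma _root_.MeasureTheory.LocallyIntegrable.integrable_mul_of_hasCompactSupport
    {u χ : Plane → ℝ} (hu : LocallyIntegrable u) (hχ : Continuous χ) (hc : HasCompactSupport χ) :
    Integrable (fun w => u w * χ w) := by
  simpa [mul_comm] using hu.integrable_smul_left_of_hasCompactSupport hχ hc

lemma hasCompactSupport_fderiv_apply {φ : Plane → ℝ} (hc : HasCompactSupport φ) (e : Plane) :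
    HasCompactSupport (fun w => fderiv ℝ φ w e) :=
  (hc.fderiv ℝ).comp_left (g := fun L : Plane →L[ℝ] ℝ => L e) (by simp)

lemma IsWeakPartial.sub {i : Fin 2} {u u' v v' : Plane → ℝ} (hu : IsWeakPartial i u u')
    (hv : IsWeakPartial i v v') :
    IsWeakPartial i (fun w => u w - v w) (fun w => u' w - v' w) := by
  refine ⟨hu.1.sub hv.1, hu.2.1.sub hv.2.1, fun φ hφ hc => ?_⟩
  have hd : Continuous fun w => fderiv ℝ φ w (EuclideanSpace.single i 1) :=
    (hφ.continuous_fderiv (by simp)).clm_apply continuous_const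
  have hdc := hasCompactSupport_fderiv_apply hc (EuclideanSpace.single i 1)
  simp_rw [sub_mul]
  rw [integral_sub (hu.1.integrable_mul_of_hasCompactSupport hd hdc)
      (hv.1.integrable_mul_of_hasCompactSupport hd hdc),
    integral_sub (hu.2.1.integrable_mul_of_hasCompactSupport hφ.continuous hc)
      (hv.2.1.integrable_mul_of_hasCompactSupport hφ.continuous hc),
    hu.2.2 φ hφ hc, hv.2.2 φ hφ hc]
  ring

/-- The product rule for a weak derivative and a cutoff function. The product has compact support,
so it may be tested against all smooth functions. -/
lemma IsWeakPartial.integral_cutoff_mul {i : Fin 2} {u u' χ : Plane → ℝ} (hu : IsWeakPartial i u u')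
    (hχ : ContDiff ℝ ∞ χ) (hc : HasCompactSupport χ) {φ : Plane → ℝ} (hφ : ContDiff ℝ ∞ φ) :
    ∫ w, (χ w * u w) * fderiv ℝ φ w (EuclideanSpace.single i 1) =
      - ∫ w, (χ w * u' w + fderiv ℝ χ w (EuclideanSpace.single i 1) * u w) * φ w := by
  set e : Plane := EuclideanSpace.single i 1
  have h := hu.2.2 (fun w => χ w * φ w) (hχ.mul hφ) hc.mul_right
  have hder w : fderiv ℝ (fun w => χ w * φ w) w e =
      χ w * fderiv ℝ φ w e + fderiv ℝ χ w e * φ w := by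
    rw [fderiv_fun_mul (hχ.differentiable (by simp) w) (hφ.differentiable (by simp) w)]
    simp [mul_comm]
  have hφd : Continuous fun w => fderiv ℝ φ w e :=
    (hφ.continuous_fderiv (by simp)).clm_apply continuous_const
  have hχd : Continuous fun w => fderiv ℝ χ w e :=
    (hχ.continuous_fderiv (by simp)).clm_apply continuous_const
  have i1 : Integrable fun w => u w * (χ w * fderiv ℝ φ w e) :=
    hu.1.integrable_mul_of_hasCompactSupport (hχ.continuous.mul hφd) hc.mul_right
  have i2 : Integrable fun w => u w * (fderiv ℝ χ w e * φ w) :=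
    hu.1.integrable_mul_of_hasCompactSupport (hχd.mul hφ.continuous)
      (hasCompactSupport_fderiv_apply hc e).mul_right
  have i3 : Integrable fun w => u' w * (χ w * φ w) :=
    hu.2.1.integrable_mul_of_hasCompactSupport (hχ.continuous.mul hφ.continuous) hc.mul_right
  have e1 : ∫ w, u w * fderiv ℝ (fun w => χ w * φ w) w e =
      (∫ w, u w * (χ w * fderiv ℝ φ w e)) + ∫ w, u w * (fderiv ℝ χ w e * φ w) := by
    rw [← integral_add i1 i2]
    congr 1 with w
    rw [hder]; ring
  have e2 : ∫ w, (χ w * u' w + fderiv ℝ χ w e * u w) * φ w =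
      (∫ w, u' w * (χ w * φ w)) + ∫ w, u w * (fderiv ℝ χ w e * φ w) := by
    rw [← integral_add i3 i2]
    congr 1 with w
    ring
  have e3 : ∫ w, (χ w * u w) * fderiv ℝ φ w e = ∫ w, u w * (χ w * fderiv ℝ φ w e) := by
    congr 1 with w
    ring
  rw [e3, e2]
  linarith

lemma TendstoTestedBy.tendsto_integral_cutoff_mul_sub {u : ℕ → Plane → ℝ} {u₀ χ ψ : Plane → ℝ}
    (h : TendstoTestedBy 2 u u₀) (hu : ∀ n, MemLpLoc 2 (u n)) (hu₀ : MemLpLoc 2 u₀)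
    (hχ : Continuous χ) (hc : HasCompactSupport χ) (hψ : MemLp ψ 2) :
    Tendsto (fun n => ∫ w, (χ w * (u n w - u₀ w)) * ψ w) atTop (𝓝 0) := by
  obtain ⟨K, hK⟩ := hχ.bounded_above_of_compact_support hc
  have hmem : MemLp (fun w => χ w * ψ w) 2 := by
    refine hψ.of_le_mul (c := K) (hχ.aestronglyMeasurable.mul hψ.1) (Eventually.of_forall fun w => ?_)
    rw [norm_mul]
    gcongr
    exact hK w
  have hlim := (h _ hmem hc.mul_right).sub_const (∫ w, u₀ w * (χ w * ψ w))
  rw [sub_self] at hlim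
  refine hlim.congr fun n => ?_
  have int {v : Plane → ℝ} (hv : MemLpLoc 2 v) : Integrable fun w => v w * (χ w * ψ w) := by
    refine ((hv.memLp_mul hχ hc).integrable_mul hψ).congr (Eventually.of_forall fun w => ?_)
    simp only [Pi.mul_apply]; ring
  rw [← integral_sub (int (hu n)) (int hu₀)]
  congr 1 with w
  ring

/-- Rellich's theorem: local weak convergence in `W^{1,2}` implies strong convergence in `L²` on
every ball. -/
lemma tendsto_eLpNorm_ball_of_tendsto_weakly {u : ℕ → Plane → ℝ} {u₀ : Plane → ℝ}
    {u' : ℕ → Fin 2 → Plane → ℝ} {u₀' : Fin 2 → Plane → ℝ}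
    (hd : ∀ n i, IsWeakPartial i (u n) (u' n i)) (hd₀ : ∀ i, IsWeakPartial i u₀ (u₀' i))
    (hu : ∀ n, MemLpLoc 2 (u n)) (hu₀ : MemLpLoc 2 u₀)
    (hu' : ∀ n i, MemLpLoc 2 (u' n i)) (hu₀' : ∀ i, MemLpLoc 2 (u₀' i))
    (hw : TendstoTestedBy 2 u u₀) (hw' : ∀ i, TendstoTestedBy 2 (fun n => u' n i) (u₀' i)) (R : ℝ) :
    Tendsto (fun n => eLpNorm (u n - u₀) 2 (volume.restrict (Metric.ball 0 R))) atTop (𝓝 0) := by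
  let b : ContDiffBump (0 : Plane) := ⟨|R| + 1, |R| + 2, by positivity, by linarith⟩
  set χ : Plane → ℝ := fun w => b w
  have hχ : ContDiff ℝ ∞ χ := b.contDiff
  have hc : HasCompactSupport χ := b.hasCompactSupport
  have hdχ i : Continuous fun w => fderiv ℝ χ w (EuclideanSpace.single i 1) :=
    (hχ.continuous_fderiv (by simp)).clm_apply continuous_const
  have hdc (i : Fin 2) := hasCompactSupport_fderiv_apply hc (EuclideanSpace.single i 1)
  have hball : tsupport χ ⊆ Metric.ball (0 : Plane) (|R| + 3) := by
    rw [b.tsupport_eq]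
    exact Metric.closedBall_subset_ball (by linarith)
  have key := tendsto_eLpNorm_two_of_weak_of_support (ρ := |R| + 3)
    (f := fun n w => χ w * (u n w - u₀ w))
    (f' := fun n i w => χ w * (u' n i w - u₀' i w) +
      fderiv ℝ χ w (EuclideanSpace.single i 1) * (u n w - u₀ w))
    (fun n => ((hu n).sub hu₀).memLp_mul hχ.continuous hc)
    (fun n i => (((hu' n i).sub (hu₀' i)).memLp_mul hχ.continuous hc).add
      (((hu n).sub hu₀).memLp_mul (hdχ i) (hdc i)))
    (fun n w hw => hball (subset_tsupport _ fun h0 => hw ?_))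
    (fun n i w hw => hball ?_)
    (fun n i φ hφ => ((hd n i).sub (hd₀ i)).integral_cutoff_mul hχ hc hφ)
    (fun ψ hψ => hw.tendsto_integral_cutoff_mul_sub hu hu₀ hχ.continuous hc hψ)
    (fun i ψ hψ => ?_)
  · refine tendsto_of_tendsto_of_tendsto_of_le_of_le tendsto_const_nhds key
      (fun _ => zero_le) fun n => ?_
    refine le_trans (le_of_eq ?_) (eLpNorm_mono_measure _
      (Measure.restrict_le_self (s := Metric.ball (0 : Plane) R)))
    refine eLpNorm_congr_ae ?_
    filter_upwards [ae_restrict_mem measurableSet_ball] with w hw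
    have : χ w = 1 := b.one_of_mem_closedBall <| by
      rw [Metric.mem_ball] at hw
      rw [Metric.mem_closedBall]
      exact hw.le.trans ((le_abs_self R).trans (le_add_of_nonneg_right zero_le_one))
    simp [this]
  · simp [h0]
  · by_contra hne
    apply hw
    have h1 : χ w = 0 := image_eq_zero_of_notMem_tsupport hne
    have h2 : fderiv ℝ χ w = 0 :=
      Function.notMem_support.1 fun h => hne (support_fderiv_subset ℝ h)
    simp [h1, h2]
  · have h1 := (hw' i).tendsto_integral_cutoff_mul_sub (fun n => hu' n i) (hu₀' i)
      hχ.continuous hc hψ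
    have h2 := hw.tendsto_integral_cutoff_mul_sub hu hu₀ (hdχ i) (hdc i) hψ
    have h3 := h1.add h2
    rw [add_zero] at h3
    refine h3.congr fun n => ?_
    refine (integral_add
      ((((hu' n i).sub (hu₀' i)).memLp_mul hχ.continuous hc).integrable_mul hψ)
      ((((hu n).sub hu₀).memLp_mul (hdχ i) (hdc i)).integrable_mul hψ)).symm.trans ?_
    congr 1 with w
    simp only [Pi.mul_apply]; ring

end Localization

/-! ### Weak derivatives of maps on the sphere -/

section WeakDerivatives

lemma IsWeakPartial.ae_unique {i : Fin 2} {u u₁ u₂ : Plane → ℝ} (h₁ : IsWeakPartial i u u₁)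
    (h₂ : IsWeakPartial i u u₂) : u₁ =ᵐ[volume] u₂ := by
  refine ae_eq_of_integral_contDiff_smul_eq h₁.2.1 h₂.2.1 fun φ hφ hc => ?_
  have e := (h₁.2.2 φ hφ hc).symm.trans (h₂.2.2 φ hφ hc)
  simpa [mul_comm] using e

lemma IsWeakPartial.congr_ae {i : Fin 2} {u v u' : Plane → ℝ} (h : IsWeakPartial i u u')
    (huv : u =ᵐ[volume] v) : IsWeakPartial i v u' := by
  refine ⟨h.1.congr huv, h.2.1, fun φ hφ hc => ?_⟩
  rw [← h.2.2 φ hφ hc]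
  refine integral_congr_ae ?_
  filter_upwards [huv] with w hw
  rw [hw]

lemma MemLpLoc.congr_ae {p : ℝ≥0∞} {u v : Plane → ℝ} (h : MemLpLoc p u)
    (huv : u =ᵐ[volume] v) : MemLpLoc p v := fun R => (h R).ae_eq (ae_restrict_of_ae huv)

lemma isWeakPartial_weakPartial {i : Fin 2} {u : Plane → ℝ} (h : ∃ u', IsWeakPartial i u u') :
    IsWeakPartial i u (weakPartial i u) := by
  rw [weakPartial, dif_pos h]
  exact h.choose_spec

variable {F : S2 → Space} (hF : MemSobolevSphere 2 2 F) (v : S2)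
include hF

lemma isWeakPartial_d1 (i : Fin 2) (α : Fin 3) : IsWeakPartial i (coord F v α) (d1 F v i α) :=
  isWeakPartial_weakPartial (((hF v α).2 i).imp fun _ h => h.1)

lemma memLpLoc_coord (α : Fin 3) : MemLpLoc 2 (coord F v α) := (hF v α).1

lemma memLpLoc_d1 (i : Fin 2) (α : Fin 3) : MemLpLoc 2 (d1 F v i α) := by
  obtain ⟨u', h1, h2⟩ := (hF v α).2 i
  exact h2.1.congr_ae (h1.ae_unique (isWeakPartial_d1 hF v i α))

lemma exists_isWeakPartial_d1 (i j : Fin 2) (α : Fin 3) :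
    ∃ u', IsWeakPartial i (d1 F v j α) u' ∧ MemLpLoc 2 u' := by
  obtain ⟨u', h1, h2⟩ := (hF v α).2 j
  obtain ⟨u'', h3, h4⟩ := h2.2 i
  exact ⟨u'', h3.congr_ae (h1.ae_unique (isWeakPartial_d1 hF v j α)), h4⟩

lemma isWeakPartial_d2 (i j : Fin 2) (α : Fin 3) :
    IsWeakPartial i (d1 F v j α) (d2 F v i j α) :=
  isWeakPartial_weakPartial ((exists_isWeakPartial_d1 hF v i j α).imp fun _ h => h.1)

lemma memLpLoc_d2 (i j : Fin 2) (α : Fin 3) : MemLpLoc 2 (d2 F v i j α) := by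
  obtain ⟨u'', h1, h2⟩ := exists_isWeakPartial_d1 hF v i j α
  exact h2.congr_ae (h1.ae_unique (isWeakPartial_d2 hF v i j α))

end WeakDerivatives

/-! ### The Willmore integrand as a function of the jet -/

noncomputable section

section Jets

/-- First-order jets `(F^α, F_i^α)` of maps into `ℝ³`, in coordinates. -/
abbrev Jet : Type := (Fin 3 → ℝ) × (Fin 2 → Fin 3 → ℝ)

/-- The first-order jet of `F` in the stereographic coordinates with pole `v`. -/
def jet (F : S2 → Space) (v : S2) (w : Plane) : Jet :=
  (fun α => coord F v α w, fun i α => d1 F v i α w)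

variable (g : Space → Matrix (Fin 3) (Fin 3) ℝ)

/-- The ambient metric at the base point of a jet. -/
def jetAmbient (q : Jet) : Matrix (Fin 3) (Fin 3) ℝ := g (WithLp.toLp 2 q.1)

/-- The pull-back metric as a function of the jet. -/
def jetMetric (q : Jet) : Matrix (Fin 2) (Fin 2) ℝ :=
  Matrix.of fun i j => ∑ α, ∑ β, jetAmbient g q α β * q.2 i α * q.2 j β

/-- The covector `F_1 × F_2` as a function of the jet. -/
def jetConormal (q : Jet) : Fin 3 → ℝ := crossProduct (q.2 0) (q.2 1)

/-- The squared `g`-length of the covector `F_1 × F_2`. -/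
def jetConormalSq (q : Jet) : ℝ := jetConormal q ⬝ᵥ ((jetAmbient g q)⁻¹ *ᵥ jetConormal q)

/-- The unit normal as a function of the jet. -/
def jetNormal (q : Jet) : Fin 3 → ℝ :=
  (Real.sqrt (jetConormalSq g q))⁻¹ • ((jetAmbient g q)⁻¹ *ᵥ jetConormal q)

/-- The coefficient of the second derivative `F_{ij}^α`, where `m = (i, j, α)`, in
`H (det ḡ)^{1/4}`. -/
def jetCoeff (m : Fin 2 × Fin 2 × Fin 3) (q : Jet) : ℝ :=
  -(Real.sqrt (Real.sqrt (jetMetric g q).det) * (jetMetric g q)⁻¹ m.1 m.2.1 *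
    ∑ δ, jetAmbient g q m.2.2 δ * jetNormal g q δ)

/-- The Christoffel term `Γ^α_{βγ} F_i^β F_j^γ`, where `m = (i, j, α)`. -/
def jetChristoffel (m : Fin 2 × Fin 2 × Fin 3) (q : Jet) : ℝ :=
  ∑ β, ∑ γ, christoffel g m.2.2 β γ (WithLp.toLp 2 q.1) * q.2 m.1 β * q.2 m.2.1 γ

lemma pullbackMetric_eq_jetMetric (F : S2 → Space) (v : S2) (w : Plane) :
    pullbackMetric g F v w = jetMetric g (jet F v w) := rfl

/-- The Willmore integrand is the square of an expression which is affine in the second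
derivatives. -/
lemma meanCurvature_sq_mul_sqrt (F : S2 → Space) (v : S2) (w : Plane) :
    meanCurvature g F v w ^ 2 * Real.sqrt (pullbackMetric g F v w).det =
      (∑ m, jetCoeff g m (jet F v w) * d2 F v m.1 m.2.1 m.2.2 w +
        ∑ m, jetCoeff g m (jet F v w) * jetChristoffel g m (jet F v w)) ^ 2 := by
  set r := Real.sqrt (Real.sqrt (pullbackMetric g F v w).det) with hr
  have hr2 : Real.sqrt (pullbackMetric g F v w).det = r ^ 2 := (Real.sq_sqrt (Real.sqrt_nonneg _)).symm
  rw [hr2, ← mul_pow, ← Finset.sum_add_distrib]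
  congr 1
  have hnu : unitNormal g F v w = jetNormal g (jet F v w) := rfl
  have hamb : metricAlong g F v w = jetAmbient g (jet F v w) := rfl
  have hsff (i j : Fin 2) : secondFundamentalForm g F v i j w =
      -∑ α, (d2 F v i j α w + jetChristoffel g (i, j, α) (jet F v w)) *
        ∑ δ, jetAmbient g (jet F v w) α δ * jetNormal g (jet F v w) δ := by
    rw [secondFundamentalForm, hnu, hamb]
    congr 1
    refine Finset.sum_congr rfl fun α _ => ?_
    rw [Finset.mul_sum]
    refine Finset.sum_congr rfl fun δ _ => ?_
    rw [← mul_assoc]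
    rfl
  simp_rw [Fintype.sum_prod_type, meanCurvature, hsff, jetCoeff, ← pullbackMetric_eq_jetMetric,
    ← hr, Finset.sum_mul]
  refine Finset.sum_congr rfl fun i _ => Finset.sum_congr rfl fun j _ => ?_
  rw [mul_neg, neg_mul, Finset.mul_sum, Finset.sum_mul, ← Finset.sum_neg_distrib]
  refine Finset.sum_congr rfl fun α _ => ?_
  ring

variable {g} (hg : IsBoundedSmoothMetric g)

/-- At a nondegenerate jet the covector `F_1 × F_2` does not vanish. -/
lemma jetConormal_ne_zero {q : Jet} (h : (jetMetric g q).det ≠ 0) : jetConormal q ≠ 0 := by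
  rw [jetConormal, crossProduct_ne_zero_iff_linearIndependent]
  by_contra hdep
  rw [LinearIndependent.pair_iff] at hdep
  push Not at hdep
  obtain ⟨s, t, hst, hne⟩ := hdep
  refine h (Matrix.exists_mulVec_eq_zero_iff.1 ⟨![s, t], fun h0 => ?_, ?_⟩)
  · exact hne (by simpa using congrFun h0 0) (by simpa using congrFun h0 1)
  · ext i
    have hβ (β : Fin 3) : s * q.2 0 β + t * q.2 1 β = 0 := by simpa using congrFun hst β
    have : (jetMetric g q *ᵥ ![s, t]) i =
        ∑ α, ∑ β, jetAmbient g q α β * q.2 i α * (s * q.2 0 β + t * q.2 1 β) := by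
      simp only [Matrix.mulVec, dotProduct, Fin.sum_univ_two, jetMetric, Matrix.of_apply,
        Matrix.cons_val_zero, Matrix.cons_val_one, Finset.sum_mul, ← Finset.sum_add_distrib]
      refine Finset.sum_congr rfl fun α _ => Finset.sum_congr rfl fun β _ => ?_
      ring
    simp [this, hβ]

lemma continuous_jet_fst_toLp : Continuous fun q : Jet => (WithLp.toLp 2 q.1 : Space) :=
  (PiLp.continuous_toLp 2 _).comp continuous_fst

lemma continuous_jetConormal : Continuous jetConormal := by
  refine continuous_pi fun α => ?_
  fin_cases α <;> simp [jetConormal, cross_apply] <;> fun_prop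

section

include hg

lemma continuous_metric : Continuous g :=
  continuous_pi fun α => continuous_pi fun β => (hg.smooth α β).continuous

lemma continuous_metric_inv : Continuous fun x => (g x)⁻¹ := by
  simp_rw [Matrix.inv_def, Ring.inverse_eq_inv']
  exact ((continuous_metric hg).matrix_det.inv₀ fun x => (hg.posDef x).det_pos.ne').smul
    (continuous_metric hg).matrix_adjugate

lemma continuous_metricPartial (γ α β : Fin 3) : Continuous (metricPartial g γ α β) :=
  ((hg.smooth α β).continuous_fderiv (by simp)).clm_apply continuous_const

lemma continuous_christoffel (α β γ : Fin 3) : Continuous (christoffel g α β γ) := by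
  refine continuous_const.mul (continuous_finsetSum _ fun δ _ => ?_)
  refine Continuous.mul ?_ ?_
  · exact (continuous_metric_inv hg).matrix_elem α δ
  · exact ((continuous_metricPartial hg _ _ _).add (continuous_metricPartial hg _ _ _)).sub
      (continuous_metricPartial hg _ _ _)

lemma continuous_jetAmbient : Continuous (jetAmbient g) :=
  (continuous_metric hg).comp continuous_jet_fst_toLp

lemma continuous_jetMetric : Continuous (jetMetric g) := by
  refine continuous_matrix fun i j => ?_
  simp only [jetMetric, Matrix.of_apply]
  refine continuous_finsetSum _ fun α _ => continuous_finsetSum _ fun β _ => ?_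
  have := (continuous_jetAmbient hg).matrix_elem α β
  fun_prop

lemma continuous_jetChristoffel (m : Fin 2 × Fin 2 × Fin 3) : Continuous (jetChristoffel g m) := by
  refine continuous_finsetSum _ fun β _ => continuous_finsetSum _ fun γ _ => ?_
  have := (continuous_christoffel hg m.2.2 β γ).comp continuous_jet_fst_toLp
  simp only [Function.comp_def] at this
  fun_prop

lemma continuous_jetAmbient_inv_mulVec :
    Continuous fun q : Jet => (jetAmbient g q)⁻¹ *ᵥ jetConormal q :=
  ((continuous_metric_inv hg).comp continuous_jet_fst_toLp).matrix_mulVec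
    (continuous_jetConormal)

lemma continuous_jetConormalSq : Continuous (jetConormalSq g) :=
  (continuous_jetConormal).dotProduct (continuous_jetAmbient_inv_mulVec hg)

lemma jetConormalSq_pos {q : Jet} (h : (jetMetric g q).det ≠ 0) : 0 < jetConormalSq g q := by
  simpa [jetConormalSq, jetAmbient] using
    (hg.posDef (WithLp.toLp 2 q.1)).inv.dotProduct_mulVec_pos (jetConormal_ne_zero h)

lemma measurable_jetCoeff (m : Fin 2 × Fin 2 × Fin 3) : Measurable (jetCoeff g m) := by
  have hdet : Measurable fun q => (jetMetric g q).det :=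
    (continuous_jetMetric hg).matrix_det.measurable
  have hinv : Measurable fun q => (jetMetric g q)⁻¹ m.1 m.2.1 := by
    simp_rw [Matrix.inv_def, Ring.inverse_eq_inv', Matrix.smul_apply]
    exact hdet.inv.smul ((continuous_jetMetric hg).matrix_adjugate.matrix_elem _ _).measurable
  have hnormal (δ : Fin 3) : Measurable fun q => jetNormal g q δ :=
    (continuous_jetConormalSq hg).measurable.sqrt.inv.mul
      ((continuous_apply δ).comp (continuous_jetAmbient_inv_mulVec hg)).measurable
  refine ((hdet.sqrt.sqrt.mul hinv).mul (Finset.measurable_fun_sum _ fun δ _ => ?_)).neg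
  exact ((continuous_jetAmbient hg).matrix_elem _ _).measurable.mul (hnormal δ)

lemma continuousAt_jetCoeff (m : Fin 2 × Fin 2 × Fin 3) {q : Jet}
    (h : (jetMetric g q).det ≠ 0) : ContinuousAt (jetCoeff g m) q := by
  have hdet : Continuous fun q => (jetMetric g q).det := (continuous_jetMetric hg).matrix_det
  have hinv : ContinuousAt (fun q => (jetMetric g q)⁻¹ m.1 m.2.1) q := by
    simp_rw [Matrix.inv_def, Ring.inverse_eq_inv', Matrix.smul_apply]
    exact (hdet.continuousAt.inv₀ h).smul
      ((continuous_jetMetric hg).matrix_adjugate.matrix_elem _ _).continuousAt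
  have hnormal (δ : Fin 3) : ContinuousAt (fun q => jetNormal g q δ) q :=
    ((continuous_jetConormalSq hg).sqrt.continuousAt.inv₀
      (Real.sqrt_pos.2 (jetConormalSq_pos hg h)).ne').mul
      ((continuous_apply δ).comp (continuous_jetAmbient_inv_mulVec hg)).continuousAt
  refine ((hdet.sqrt.sqrt.continuousAt.mul hinv).mul (tendsto_finsetSum _ fun δ _ => ?_)).neg
  exact ((continuous_jetAmbient hg).matrix_elem _ _).continuousAt.mul (hnormal δ)

end

end Jets

/-! ### Lower semicontinuity of the Willmore energy -/

section Semicontinuity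

/-- Finitely many sequences converging in `L²` have a common subsequence converging almost
everywhere. -/
lemma exists_subseq_forall_tendsto_ae {α κ : Type*} [MeasurableSpace α] {μ : Measure α} [Fintype κ]
    {u : ℕ → κ → α → ℝ} {u₀ : κ → α → ℝ} (hu : ∀ n k, AEStronglyMeasurable (u n k) μ)
    (hu₀ : ∀ k, AEStronglyMeasurable (u₀ k) μ)
    (h : ∀ k, Tendsto (fun n => eLpNorm (u n k - u₀ k) 2 μ) atTop (𝓝 0)) :
    ∃ ns : ℕ → ℕ, StrictMono ns ∧
      ∀ᵐ x ∂μ, ∀ k, Tendsto (fun j => u (ns j) k x) atTop (𝓝 (u₀ k x)) := by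
  set S : ℕ → α → ℝ := fun n => ∑ k, |u n k - u₀ k| with hS
  have hm n k : AEStronglyMeasurable |u n k - u₀ k| μ := ((hu n k).sub (hu₀ k)).norm
  have hSm n : AEStronglyMeasurable (S n) μ := Finset.aestronglyMeasurable_sum _ fun k _ => hm n k
  have hSlim : Tendsto (fun n => eLpNorm (S n - 0) 2 μ) atTop (𝓝 0) := by
    have hsum : Tendsto (fun n => ∑ k, eLpNorm (u n k - u₀ k) 2 μ) atTop (𝓝 0) := by
      simpa using tendsto_finsetSum Finset.univ fun k _ => h k
    refine tendsto_of_tendsto_of_tendsto_of_le_of_le tendsto_const_nhds hsum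
      (fun _ => zero_le) fun n => ?_
    rw [sub_zero]
    refine (eLpNorm_sum_le (fun k _ => hm n k) one_le_two).trans ?_
    exact Finset.sum_le_sum fun k _ => (eLpNorm_norm (u n k - u₀ k)).le
  obtain ⟨ns, hns, hae⟩ := (tendstoInMeasure_of_tendsto_eLpNorm two_ne_zero hSm
    aestronglyMeasurable_zero hSlim).exists_seq_tendsto_ae
  refine ⟨ns, hns, ?_⟩
  filter_upwards [hae] with x hx k
  rw [tendsto_iff_norm_sub_tendsto_zero]
  refine squeeze_zero (fun _ => norm_nonneg _) (fun j => ?_) hx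
  simp only [hS, Finset.sum_apply, Pi.abs_apply, Pi.sub_apply]
  exact Finset.single_le_sum (f := fun k => |u (ns j) k x - u₀ k x|) (fun _ _ => abs_nonneg _)
    (Finset.mem_univ k)

lemma TendstoTestedBy.tendsto_setIntegral_ball {u : ℕ → Plane → ℝ} {u₀ ψ : Plane → ℝ}
    (h : TendstoTestedBy 2 u u₀) {R : ℝ}
    (hψ : MemLp ψ 2 (volume.restrict (Metric.ball 0 R))) :
    Tendsto (fun n => ∫ w in Metric.ball 0 R, u n w * ψ w) atTop
      (𝓝 (∫ w in Metric.ball 0 R, u₀ w * ψ w)) := by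
  have e (v : Plane → ℝ) : ∫ w in Metric.ball 0 R, v w * ψ w =
      ∫ w, v w * (Metric.ball (0 : Plane) R).indicator ψ w := by
    rw [← integral_indicator measurableSet_ball]
    congr 1 with w
    by_cases hw : w ∈ Metric.ball (0 : Plane) R <;> simp [hw]
  simp_rw [e]
  refine h _ ((memLp_indicator_iff_restrict measurableSet_ball).2 hψ) ?_
  exact HasCompactSupport.intro (isCompact_closedBall (0 : Plane) R) fun w hw =>
    Set.indicator_of_notMem (fun h => hw (Metric.ball_subset_closedBall h)) _

variable {g : Space → Matrix (Fin 3) (Fin 3) ℝ} (hg : IsBoundedSmoothMetric g)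
  {F : S2 → Space} {Fk : ℕ → S2 → Space}

lemma aemeasurable_jet (hF : MemSobolevSphere 2 2 F) (v : S2) : AEMeasurable (jet F v) := by
  refine AEMeasurable.prodMk (aemeasurable_pi_lambda _ fun α => ?_)
    (aemeasurable_pi_lambda _ fun i => aemeasurable_pi_lambda _ fun α => ?_)
  · exact (isWeakPartial_d1 hF v 0 α).1.aestronglyMeasurable.aemeasurable
  · exact (isWeakPartial_d1 hF v i α).2.1.aestronglyMeasurable.aemeasurable

/-- Weak convergence in `W^{2,2}` implies convergence of the jets almost everywhere in a given
ball, along a subsequence. -/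
lemma exists_subseq_tendsto_jet (hFk : ∀ k, MemSobolevSphere 2 2 (Fk k))
    (hF : MemSobolevSphere 2 2 F) (hweak : TendstoWeaklyW22 Fk F) (v : S2) (R : ℝ) :
    ∃ ns : ℕ → ℕ, StrictMono ns ∧ ∀ᵐ w ∂(volume.restrict (Metric.ball 0 R)),
      Tendsto (fun j => jet (Fk (ns j)) v w) atTop (𝓝 (jet F v w)) := by
  let comp (F : S2 → Space) : Fin 3 ⊕ Fin 2 × Fin 3 → Plane → ℝ :=
    Sum.elim (fun α => coord F v α) (fun p => d1 F v p.1 p.2)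
  have hmeas {F : S2 → Space} (hF : MemSobolevSphere 2 2 F) (k) :
      AEStronglyMeasurable (comp F k) (volume.restrict (Metric.ball 0 R)) := by
    rcases k with α | ⟨i, α⟩
    · exact (memLpLoc_coord hF v α R).1
    · exact (memLpLoc_d1 hF v i α R).1
  obtain ⟨ns, hns, hae⟩ := exists_subseq_forall_tendsto_ae
    (u := fun n => comp (Fk n)) (u₀ := comp F) (fun n => hmeas (hFk n)) (hmeas hF) (by
      rintro (α | ⟨i, α⟩)
      · exact tendsto_eLpNorm_ball_of_tendsto_weakly
          (fun n i => isWeakPartial_d1 (hFk n) v i α) (fun i => isWeakPartial_d1 hF v i α)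
          (fun n => memLpLoc_coord (hFk n) v α) (memLpLoc_coord hF v α)
          (fun n i => memLpLoc_d1 (hFk n) v i α) (fun i => memLpLoc_d1 hF v i α)
          (hweak v α).1 (hweak v α).2.1 R
      · exact tendsto_eLpNorm_ball_of_tendsto_weakly
          (fun n j => isWeakPartial_d2 (hFk n) v j i α) (fun j => isWeakPartial_d2 hF v j i α)
          (fun n => memLpLoc_d1 (hFk n) v i α) (memLpLoc_d1 hF v i α)
          (fun n j => memLpLoc_d2 (hFk n) v j i α) (fun j => memLpLoc_d2 hF v j i α)
          ((hweak v α).2.1 i) (fun j => (hweak v α).2.2 j i) R)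
  refine ⟨ns, hns, ?_⟩
  filter_upwards [hae] with w hw
  refine Tendsto.prodMk_nhds (tendsto_pi_nhds.2 fun α => hw (Sum.inl α))
    (tendsto_pi_nhds.2 fun i => tendsto_pi_nhds.2 fun α => hw (Sum.inr (i, α)))

include hg in
/-- Sublevel sets of the Willmore energy in a coordinate ball are closed under weak convergence. -/
lemma lintegral_ball_le_of_tendstoWeakly (hFk : ∀ k, MemSobolevSphere 2 2 (Fk k))
    (hF : MemSobolevSphere 2 2 F) (hweak : TendstoWeaklyW22 Fk F) (v : S2)
    (hdet : ∀ᵐ w, (pullbackMetric g F v w).det ≠ 0) (R : ℝ) {c : ℝ≥0∞} (hc : c ≠ ⊤)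
    (h : ∀ k, ∫⁻ w in Metric.ball 0 R, ENNReal.ofReal
      (meanCurvature g (Fk k) v w ^ 2 * Real.sqrt (pullbackMetric g (Fk k) v w).det) ≤ c) :
    ∫⁻ w in Metric.ball 0 R, ENNReal.ofReal
      (meanCurvature g F v w ^ 2 * Real.sqrt (pullbackMetric g F v w).det) ≤ c := by
  obtain ⟨ns, hns, hlim⟩ := exists_subseq_tendsto_jet hFk hF hweak v R
  simp_rw [meanCurvature_sq_mul_sqrt] at h ⊢
  have hjet {F : S2 → Space} (hF : MemSobolevSphere 2 2 F) :
      AEMeasurable (jet F v) (volume.restrict (Metric.ball 0 R)) := (aemeasurable_jet hF v).restrict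
  have hA {F : S2 → Space} (hF : MemSobolevSphere 2 2 F) (m) : AEStronglyMeasurable
      (fun w => jetCoeff g m (jet F v w)) (volume.restrict (Metric.ball 0 R)) :=
    ((measurable_jetCoeff hg m).comp_aemeasurable (hjet hF)).aestronglyMeasurable
  have hΓ {F : S2 → Space} (hF : MemSobolevSphere 2 2 F) (m) : AEStronglyMeasurable
      (fun w => jetChristoffel g m (jet F v w)) (volume.restrict (Metric.ball 0 R)) :=
    ((continuous_jetChristoffel hg m).measurable.comp_aemeasurable (hjet hF)).aestronglyMeasurable
  have hB {F : S2 → Space} (hF : MemSobolevSphere 2 2 F) : AEStronglyMeasurable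
      (fun w => ∑ m, jetCoeff g m (jet F v w) * jetChristoffel g m (jet F v w))
      (volume.restrict (Metric.ball 0 R)) :=
    Finset.aestronglyMeasurable_fun_sum _ fun m _ => (hA hF m).mul (hΓ hF m)
  have hAlim (m) : ∀ᵐ w ∂(volume.restrict (Metric.ball 0 R)), Tendsto
      (fun j => jetCoeff g m (jet (Fk (ns j)) v w)) atTop (𝓝 (jetCoeff g m (jet F v w))) := by
    filter_upwards [hlim, ae_restrict_of_ae hdet] with w hw hw'
    rw [pullbackMetric_eq_jetMetric] at hw'
    exact (continuousAt_jetCoeff hg m hw').tendsto.comp hw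
  have : IsFiniteMeasure (volume.restrict (Metric.ball (0 : Plane) R)) :=
    ⟨(Measure.restrict_apply_univ _).trans_lt measure_ball_lt_top⟩
  have hBlim : ∀ᵐ w ∂(volume.restrict (Metric.ball 0 R)), Tendsto
      (fun j => ∑ m, jetCoeff g m (jet (Fk (ns j)) v w) * jetChristoffel g m (jet (Fk (ns j)) v w))
      atTop (𝓝 (∑ m, jetCoeff g m (jet F v w) * jetChristoffel g m (jet F v w))) := by
    filter_upwards [ae_all_iff.2 hAlim, hlim] with w hw hw'
    exact tendsto_finsetSum _ fun m _ =>
      (hw m).mul (((continuous_jetChristoffel hg m).tendsto _).comp hw')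
  have hY (m : Fin 2 × Fin 2 × Fin 3) (ψ : Plane → ℝ)
      (hψ : MemLp ψ 2 (volume.restrict (Metric.ball 0 R))) :
      Tendsto (fun j => ∫ w in Metric.ball 0 R, d2 (Fk (ns j)) v m.1 m.2.1 m.2.2 w * ψ w) atTop
        (𝓝 (∫ w in Metric.ball 0 R, d2 F v m.1 m.2.1 m.2.2 w * ψ w)) :=
    (((hweak v m.2.2).2.2 m.1 m.2.1).tendsto_setIntegral_ball hψ).comp hns.tendsto_atTop
  exact lintegral_sq_le_of_weak_tendsto
    (A := fun j m w => jetCoeff g m (jet (Fk (ns j)) v w))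
    (A' := fun m w => jetCoeff g m (jet F v w))
    (Y := fun j m => d2 (Fk (ns j)) v m.1 m.2.1 m.2.2) (Y' := fun m => d2 F v m.1 m.2.1 m.2.2)
    (fun j => hA (hFk (ns j))) (hA hF) (fun j => hB (hFk (ns j))) (hB hF)
    (fun j m => memLpLoc_d2 (hFk (ns j)) v _ _ _ R) (fun m => memLpLoc_d2 hF v _ _ _ R)
    hY hAlim hBlim hc (fun j => h (ns j))

include hg in
lemma willmore_le_of_tendstoWeakly (hFk : ∀ k, MemSobolevSphere 2 2 (Fk k))
    (hF : MemSobolevSphere 2 2 F) (hweak : TendstoWeaklyW22 Fk F)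
    (hdet : ∀ᵐ w, (pullbackMetric g F northPole w).det ≠ 0) {c : ℝ≥0∞} (hc : c ≠ ⊤)
    (h : ∀ k, willmore g (Fk k) ≤ c) : willmore g F ≤ c := by
  have two_mul_le {a : ℝ≥0∞} : 2⁻¹ * a ≤ c ↔ a ≤ 2 * c :=
    ENNReal.inv_mul_le_iff two_ne_zero ENNReal.ofNat_ne_top
  simp only [willmore, two_mul_le] at h ⊢
  have hunion : ⋃ n : ℕ, Metric.ball (0 : Plane) n = Set.univ := Metric.iUnion_ball_nat 0
  rw [← setLIntegral_univ, ← hunion, setLIntegral_iUnion_of_directed]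
  · refine iSup_le fun n => lintegral_ball_le_of_tendstoWeakly hg hFk hF hweak _ hdet n
      (by finiteness) fun k => ?_
    exact (setLIntegral_le_lintegral _ _).trans (h k)
  · exact (monotone_nat_of_le_succ fun n =>
      Metric.ball_subset_ball (by push_cast; linarith)).directed_le

end Semicontinuity

end

end WillmoreLSC

theorem mainTheorem10
    (g : WillmoreLSC.Space → Matrix (Fin 3) (Fin 3) ℝ)
    (hg : WillmoreLSC.IsBoundedSmoothMetric g)
    (Fk : ℕ → WillmoreLSC.S2 → WillmoreLSC.Space)
    (F : WillmoreLSC.S2 → WillmoreLSC.Space)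
    (hFk : ∀ k, WillmoreLSC.MemB g (Fk k))
    (hF : WillmoreLSC.MemB g F)
    (hweak : WillmoreLSC.TendstoWeaklyW22 Fk F)
    (hweakStar : WillmoreLSC.TendstoWeakStarW1Infty Fk F) :
    WillmoreLSC.willmore g F ≤
      Filter.liminf (fun k => WillmoreLSC.willmore g (Fk k)) Filter.atTop := by
  by_contra! hlt
  obtain ⟨c, hc, hcF⟩ := exists_between hlt
  obtain ⟨ns, hns, hle⟩ := extraction_of_frequently_atTop (frequently_lt_of_liminf_lt (h := hc))
  refine hcF.not_ge (WillmoreLSC.willmore_le_of_tendstoWeakly hg (Fk := fun k => Fk (ns k))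
    (fun k => (hFk (ns k)).memW22) hF.memW22 (fun v α => ?_) (hF.nondegenerate _) hcF.ne_top
    fun k => (hle k).le)
  obtain ⟨h0, h1, h2⟩ := hweak v α
  exact ⟨fun ψ hψ hs => (h0 ψ hψ hs).comp hns.tendsto_atTop,
    fun i ψ hψ hs => (h1 i ψ hψ hs).comp hns.tendsto_atTop,
    fun i j ψ hψ hs => (h2 i j ψ hψ hs).comp hns.tendsto_atTop⟩
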